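/- Consider the (metric) prize-collecting travelling salesperson problem (PCTSP): given a complete undirected graph $G=(V,E)$ on a finite vertex set, edge lengths $c_e\ge 0$ ($e\in E$) satisfying the triangle inequality, a root $r\in V$, and penalties $\pi_v\ge 0$ for $v\in V\setminus\{r\}$ (with $\pi_r:=0$), find a cycle $C=(V_C,E_C)$ in $G$ that contains $r$ and minimizes $\sum_{e\in E_C}c_e+\sum_{v\in V\setminus V_C}\pi_v$. Here degenerate cycles are allowed: the cycle consisting of $r$ only, of length $0$, and the cycles on two vertices $r,v$, which traverse the edge $\{r,v\}$ twice and have length $2c_{\{r,v\}}$. For $S\subseteq V$ let $\delta(S)$ be the set of edges with exactly one endpoint in $S$, let $\delta(v):=\delta(\{v\})$, and for $F\subseteq E$ let $x(F):=\sum_{e\in F}x_e$. The PCTSP LP relaxation is $$ \begin{array}{rrcll} \min & \displaystyle \sum_{e\in E}c_ex_e + \sum_{v\in V}\pi_v (1-y_v) \\ & x(\delta(v)) & = & 2y_v & \forall v\in V\setminus\{r\} \\ & x(\delta(r)) & \le & 2 \\ & x(\delta(S)) & \geq & 2y_v & \forall S\subseteq V\setminus\{r\},\ v\in S\\ & y_r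 & = & 1 \\ & x_e & \geq & 0 & \forall e\in E\\ & y_v & \in & [0,1] & \forall v\in V . \end{array} $$ The integrality gap of this relaxation, i.e. the supremum over all PCTSP instances of the ratio of the optimal value of PCTSP to the optimal value of the LP relaxation (where instances for which both values are $0$ are disregarded, and the ratio is $\infty$ if only the LP value is $0$), is less than $1.774$. -/

import Mathlib

open scoped ENNReal

universe u

namespace PCTSP

open Classical in
/-- The edge set `E` of the complete undirected graph on `V`. -/
noncomputable def edges (V : Type u) [Fintype V] : Finset (Sym2 V) :=
  (⊤ : SimpleGraph V).edgeFinset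

open Classical in
/-- The cut `δ(S)`: all edges with exactly one endpoint in `S`. -/
noncomputable def cut {V : Type u} [Fintype V] (S : Finset V) : Finset (Sym2 V) :=
  {e ∈ edges V | ∃ u ∈ S, ∃ v, v ∉ S ∧ e = s(u, v)}

/-- An instance of (metric) prize-collecting TSP on the vertex set `V`. Only the values of
`length` on edges, that is on `s(u, v)` with `u ≠ v`, matter. -/
structure Instance (V : Type u) where
  /-- the edge lengths `c` -/
  length : Sym2 V → ℝ
  length_nonneg : ∀ u v, u ≠ v → 0 ≤ length s(u, v)
  length_triangle : ∀ u v w, u ≠ v → v ≠ w → u ≠ w →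
    length s(u, w) ≤ length s(u, v) + length s(v, w)
  /-- the root `r` -/
  root : V
  /-- the penalties `π`, with `π r = 0` by convention -/
  penalty : V → ℝ
  penalty_nonneg : ∀ v, v ≠ root → 0 ≤ penalty v
  penalty_root : penalty root = 0

variable {V : Type u} [Fintype V]

/-- A (possibly degenerate) cycle through `r` in the complete graph: a closed walk at `r` that is
either the root only, or traverses an edge `{r, v}` back and forth (a cycle on two vertices),
or is a cycle of the simple complete graph. -/
def IsTour {V : Type u} {r : V} (C : (⊤ : SimpleGraph V).Walk r r) : Prop :=
  C.length = 0 ∨ C.length = 2 ∨ C.IsCycle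

open Classical in
/-- Length of the traversed edges (with multiplicity, so that a cycle on the two vertices `r, v`
has length `2 c(r, v)`) plus the penalties of the vertices that are not visited. -/
noncomputable def Instance.tourCost (I : Instance V)
    (C : (⊤ : SimpleGraph V).Walk I.root I.root) : ℝ :=
  (C.edges.map I.length).sum + ∑ v with v ∉ C.support, I.penalty v

/-- The optimal value of the prize-collecting TSP instance. -/
noncomputable def Instance.opt (I : Instance V) : ℝ≥0∞ :=
  ⨅ (C : (⊤ : SimpleGraph V).Walk I.root I.root) (_ : IsTour C), ENNReal.ofReal (I.tourCost C)

/-- Feasible solutions `(x, y)` of the PCTSP LP relaxation with root `r`. Only the values of `x` on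
edges matter. -/
structure LPFeasible (r : V) (x : Sym2 V → ℝ) (y : V → ℝ) : Prop where
  degree_eq : ∀ v, v ≠ r → ∑ e ∈ cut {v}, x e = 2 * y v
  degree_root_le : ∑ e ∈ cut {r}, x e ≤ 2
  cut_ge : ∀ S : Finset V, r ∉ S → ∀ v ∈ S, 2 * y v ≤ ∑ e ∈ cut S, x e
  y_root : y r = 1
  x_nonneg : ∀ e ∈ edges V, 0 ≤ x e
  y_mem : ∀ v, y v ∈ Set.Icc (0 : ℝ) 1

/-- The objective function of the PCTSP LP relaxation. -/
noncomputable def Instance.lpCost (I : Instance V) (x : Sym2 V → ℝ) (y : V → ℝ) : ℝ :=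
  ∑ e ∈ edges V, I.length e * x e + ∑ v, I.penalty v * (1 - y v)

/-- The optimal value of the PCTSP LP relaxation. -/
noncomputable def Instance.lpOpt (I : Instance V) : ℝ≥0∞ :=
  ⨅ (x : Sym2 V → ℝ) (y : V → ℝ) (_ : LPFeasible I.root x y), ENNReal.ofReal (I.lpCost x y)

/-- The integrality gap of the PCTSP LP relaxation: the supremum, over all instances, of the ratio
of the optimal values. Here `a / 0 = ∞` for `a > 0`, while `0 / 0 = 0`, so that instances for which
both values vanish do not contribute. -/
noncomputable def integralityGap : ℝ≥0∞ :=
  ⨆ (V : Type u) (_ : Fintype V) (I : Instance V), I.opt / I.lpOpt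

end PCTSP

/-!
The proof gives the bound `5 / 3`: every feasible solution `(x, y)` of the relaxation is matched by a
tour of cost at most `5 / 3` times its objective value.

Tours are built as in Christofides' algorithm, from a tree `T` through the root that need not reach
all vertices. For a threshold `γ`, prune `T` to the union of the paths from the root to the tree
vertices `v` with `γ ≤ y v`. A tree edge survives if and only if `γ` is at most the largest value `η`
of `y` below that edge. The parity of the pruned tree is corrected by a perfect matching of its
vertices of odd degree, which is bounded by the weights `x / 3`, plus `1 - 2 η / 3` on each surviving
tree edge. These weights form a fractional join: a cut with an odd number of odd vertices contains an
odd number of tree edges. If it contains at least three, each of them contributes at least `1 / 3`,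
because `η ≤ 1`. If it contains exactly one, it separates the root from a vertex `v` with `y v = η`,
so that `x` has weight at least `2 η` on it (`RootedTree.isFractionalJoin_joinWeight`). Hence the tour
is at most as long as a third of `x`, plus `2 - 2 η / 3` times each surviving edge
(`RootedTree.exists_tour`).

The threshold is random with distribution function `F t = max 0 ((5 t - 2) / (3 t))`. On average a
tree edge of length `c` then costs at most `F η (2 - 2 η / 3) c ≤ 4 / 3 c`, no matter what `η` is, and
a vertex `v` of `T` is visited with probability at least `F (y v)`. It therefore suffices to have a
tree whose length, minus rewards proportional to `π v * F (y v)` for its vertices, is at most the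
corresponding quantity for `(x, y)`. No distribution over trees is needed: such a tree is what the
primal-dual algorithm of Goemans and Williamson for prize-collecting Steiner trees finds
(`IsCutSolution.hasCheapTree`). Since `t * F t ≥ (5 t - 2) / 3`, the expected penalties are also within
a factor `5 / 3` (`Instance.exists_tour_le`).

The classical results this rests on are proved on the way. That a fractional join is at least as long
as a matching (`IsFractionalJoin.exists_matching`) follows by splitting off from Edmonds' perfect
matching theorem (`matchingDominated`), which in turn is derived from Birkhoff's theorem by induction,
contracting tight odd cuts. Euler walks of multigraphs (`exists_euler_walk`) turn the tree and the
matching into a closed walk, which the triangle inequality allows to shortcut to a tour.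
-/

namespace PCTSP

/-! ### Rooted trees -/

section

/-- A tree with root `r` on the vertex set `verts`, encoded by the parent of every vertex other than
`r`. The function `rank`, which strictly decreases towards the root, witnesses that there are no
cycles. Values of `parent` and `rank` off `verts`, and `parent r`, are irrelevant. -/
structure RootedTree (V : Type u) (r : V) where
  /-- the vertices of the tree -/
  verts : Finset V
  /-- the next vertex on the way to the root -/
  parent : V → V
  /-- a certificate of acyclicity -/
  rank : V → ℕ
  root_mem : r ∈ verts
  parent_mem : ∀ v ∈ verts, v ≠ r → parent v ∈ verts
  rank_parent_lt : ∀ v ∈ verts, v ≠ r → rank (parent v) < rank v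

variable {V : Type u} {r : V}

/-- The total length of the edges of a rooted tree. -/
def RootedTree.cost [DecidableEq V] (T : RootedTree V r) (c : V → V → ℝ) : ℝ :=
  ∑ v ∈ T.verts.erase r, c v (T.parent v)

theorem RootedTree.parent_ne (T : RootedTree V r) {v : V} (hv : v ∈ T.verts) (hr : v ≠ r) :
    v ≠ T.parent v := by
  intro h
  have := T.rank_parent_lt v hv hr
  rw [← h] at this
  exact lt_irrefl _ this

variable [DecidableEq V]

/-- Leaves that carry no penalty can be removed from a tree. -/
theorem RootedTree.exists_pruned (c : V → V → ℝ) (π : V → ℝ) (W : Finset V)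
    (hc : ∀ u ∈ W, ∀ v ∈ W, u ≠ v → 0 ≤ c u v) :
    ∀ (n : ℕ) (T : RootedTree V r), T.verts.card = n → T.verts ⊆ W →
      ∃ T' : RootedTree V r, T'.verts ⊆ W ∧
        T'.cost c + 2 * ∑ v ∈ W \ T'.verts, π v ≤ T.cost c + 2 * ∑ v ∈ W \ T.verts, π v ∧
        ∀ v ∈ T'.verts, v ≠ r → π v = 0 → ∃ w ∈ T'.verts.erase r, T'.parent w = v := by
  intro n
  induction n with
  | zero =>
    intro T hT
    exact absurd T.root_mem (by simp [Finset.card_eq_zero.1 hT])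
  | succ n ih =>
    intro T hT hW
    by_cases h : ∀ v ∈ T.verts, v ≠ r → π v = 0 → ∃ w ∈ T.verts.erase r, T.parent w = v
    · exact ⟨T, hW, le_rfl, h⟩
    push Not at h
    obtain ⟨l, hl, hlr, hl0, hleaf⟩ := h
    let T₁ : RootedTree V r :=
      { verts := T.verts.erase l
        parent := T.parent
        rank := T.rank
        root_mem := Finset.mem_erase.2 ⟨hlr.symm, T.root_mem⟩
        parent_mem := fun v hv hvr => by
          have hv' := Finset.mem_of_mem_erase hv
          exact Finset.mem_erase.2 ⟨hleaf v (Finset.mem_erase.2 ⟨hvr, hv'⟩), T.parent_mem v hv' hvr⟩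
        rank_parent_lt := fun v hv hvr => T.rank_parent_lt v (Finset.mem_of_mem_erase hv) hvr }
    obtain ⟨T', h1, h2, h3⟩ := ih T₁ (by
      change (T.verts.erase l).card = n
      rw [Finset.card_erase_of_mem hl, hT]; rfl) ((Finset.erase_subset _ _).trans hW)
    refine ⟨T', h1, h2.trans ?_, h3⟩
    have e1 : T.cost c = T₁.cost c + c l (T.parent l) := by
      change ∑ v ∈ T.verts.erase r, c v (T.parent v)
        = ∑ v ∈ (T.verts.erase l).erase r, c v (T.parent v) + _
      rw [Finset.erase_right_comm, Finset.sum_erase_add]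
      exact Finset.mem_erase.2 ⟨hlr, hl⟩
    have e2 : ∑ v ∈ W \ T₁.verts, π v = ∑ v ∈ W \ T.verts, π v := by
      change ∑ v ∈ W \ T.verts.erase l, π v = _
      rw [Finset.sdiff_erase (hW hl), Finset.sum_insert (by simp [hl]), hl0, zero_add]
    have := hc l (hW hl) _ (hW (T.parent_mem l hl hlr)) (T.parent_ne hl hlr)
    rw [e1, e2]; linarith

/-- The lengths after contracting `v` into `u`: of two parallel edges the shorter one is kept. -/
def contractLen (c : V → V → ℝ) (u v a b : V) : ℝ :=
  if a = u then min (c u b) (c v b) else if b = u then min (c a u) (c a v) else c a b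

/-- The edge weights after contracting `v` into `u`: weights of parallel edges are added. -/
def contractWeight (x : V → V → ℝ) (u v a b : V) : ℝ :=
  if a = b then 0 else x a b + (if a = u then x v b else 0) + (if b = u then x a v else 0)

/-- A tree in the graph where `v` is contracted into `u` along an edge of length `0` lifts to a tree
of at most the same length. -/
theorem RootedTree.exists_lift (c : V → V → ℝ) (hsymm : ∀ a b, c a b = c b a) {u v : V}
    (huv : u ≠ v) (hvr : v ≠ r) (h0 : c u v = 0) (T : RootedTree V r) (hv : v ∉ T.verts)
    (hu : u ∈ T.verts) :
    ∃ T' : RootedTree V r, T'.verts = insert v T.verts ∧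
      T'.cost c ≤ T.cost (contractLen c u v) := by
  -- the end of the zero edge that is closer to `w`
  let cl : V → V := fun w => if c v w < c u w then v else u
  have hcl : ∀ w, c w (cl w) = min (c u w) (c v w) := by
    intro w
    by_cases h : c v w < c u w
    · simp [cl, h, min_eq_right h.le, hsymm w v]
    · simp [cl, h, min_eq_left (not_lt.1 h), hsymm w u]
  have hclm : ∀ w, cl w = u ∨ cl w = v := by
    intro w
    by_cases h : c v w < c u w <;> simp [cl, h]
  by_cases hur : u = r
  · let T' : RootedTree V r :=
      { verts := insert v T.verts
        parent := fun w => if w = v then u else if T.parent w = u then cl w else T.parent w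
        rank := fun w => if w = v then 2 * T.rank u + 1 else 2 * T.rank w
        root_mem := Finset.mem_insert_of_mem T.root_mem
        parent_mem := fun w hw hwr => by
          by_cases hwv : w = v
          · simp [hwv, hu]
          have hw' : w ∈ T.verts := by simpa [hwv] using hw
          have := T.parent_mem w hw' hwr
          rcases hclm w with h | h <;> by_cases hp : T.parent w = u <;> simp [hwv, hp, h, hu, this]
        rank_parent_lt := fun w hw hwr => by
          by_cases hwv : w = v
          · simp [hwv, huv]
          have hw' : w ∈ T.verts := by simpa [hwv] using hw
          have h1 := T.rank_parent_lt w hw' hwr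
          have h2 : T.parent w ≠ v := fun h => hv (h ▸ T.parent_mem w hw' hwr)
          by_cases hp : T.parent w = u
          · rw [hp] at h1
            rcases hclm w with h | h <;> simp [hwv, hp, h, huv] <;> omega
          · simp [hwv, hp, h2, h1] }
    refine ⟨T', rfl, ?_⟩
    change ∑ w ∈ (insert v T.verts).erase r, c w (if w = v then u else _) ≤ _
    rw [Finset.erase_insert_of_ne hvr, Finset.sum_insert (by simp [hv])]
    simp only [if_true]
    rw [hsymm v u, h0, zero_add]
    apply Finset.sum_le_sum
    intro w hw
    have hw2 := Finset.mem_of_mem_erase hw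
    have hwr := Finset.ne_of_mem_erase hw
    have hwv : w ≠ v := fun h => hv (h ▸ hw2)
    have hwu : w ≠ u := hur ▸ hwr
    by_cases hp : T.parent w = u
    · simp only [hwv, hp, hwu, if_true, if_false, contractLen, hcl]
      rw [hsymm w u, hsymm w v]
    · simp [hwv, hp, hwu, contractLen]
  · -- `q` is the parent of the contracted vertex; `cl q` takes over the edge to `q`, and the other
    -- end `ot q` of the zero edge becomes a child of `cl q`
    set q := T.parent u with hq
    let ot : V := if c v q < c u q then u else v
    have hcases : (cl q = u ∧ ot = v) ∨ (cl q = v ∧ ot = u) := by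
      by_cases h : c v q < c u q <;> simp [cl, ot, h]
    have hotne : ot ≠ cl q := by
      rcases hcases with ⟨h1, h2⟩ | ⟨h1, h2⟩ <;> rw [h1, h2]
      exacts [huv.symm, huv]
    have hqm : q ∈ T.verts := T.parent_mem u hu hur
    have hqv : q ≠ v := fun h => hv (h ▸ hqm)
    have hqu : q ≠ u := (T.parent_ne hu hur).symm
    have huq := T.rank_parent_lt u hu hur
    rw [← hq] at huq
    have hrk : ∀ w, w ≠ u → w ≠ v → w ≠ cl q ∧ w ≠ ot := by
      intro w h1 h2
      rcases hcases with ⟨h3, h4⟩ | ⟨h3, h4⟩ <;> rw [h3, h4] <;> tauto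
    let rk : V → ℕ := fun w =>
      if w = cl q then 2 * T.rank u else if w = ot then 2 * T.rank u + 1 else 2 * T.rank w
    let pa : V → V := fun w =>
      if w = cl q then q else if w = ot then cl q else
        if T.parent w = u then cl w else T.parent w
    have hmem : ∀ w, cl w ∈ insert v T.verts := fun w => by
      rcases hclm w with h | h <;> simp [h, hu]
    let T' : RootedTree V r :=
      { verts := insert v T.verts
        parent := pa
        rank := rk
        root_mem := Finset.mem_insert_of_mem T.root_mem
        parent_mem := fun w hw hwr => by
          by_cases h1 : w = cl q
          · simp [pa, h1, hqm]
          by_cases h2 : w = ot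
          · have := hmem q
            simpa [pa, h2, hotne] using this
          have hw' : w ∈ T.verts := by
            rcases Finset.mem_insert.1 hw with h | h
            · rcases hcases with ⟨h3, h4⟩ | ⟨h3, h4⟩
              · exact absurd (h.trans h4.symm) h2
              · exact absurd (h.trans h3.symm) h1
            · exact h
          by_cases hp : T.parent w = u
          · have := hmem w
            simpa [pa, h1, h2, hp] using this
          · have := T.parent_mem w hw' hwr
            simp [pa, h1, h2, hp, this]
        rank_parent_lt := fun w hw hwr => by
          by_cases h1 : w = cl q
          · have := hrk q hqu hqv
            simp [pa, rk, h1, this, huq]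
          by_cases h2 : w = ot
          · simp [pa, rk, h2, hotne]
          have hwuv : w ≠ u ∧ w ≠ v := by
            rcases hcases with ⟨h3, h4⟩ | ⟨h3, h4⟩ <;> rw [h3] at h1 <;> rw [h4] at h2 <;> tauto
          have hw' : w ∈ T.verts := by simpa [hwuv.2] using hw
          have h3 := T.rank_parent_lt w hw' hwr
          by_cases hp : T.parent w = u
          · rw [hp] at h3
            have : rk (cl w) ≤ 2 * T.rank u + 1 := by
              rcases hclm w with h | h <;> rw [h] <;>
                rcases hcases with ⟨h5, h6⟩ | ⟨h5, h6⟩ <;>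
                simp [rk, h5, h6, huv, huv.symm]
            have e1 : pa w = cl w := by simp [pa, h1, h2, hp]
            have e2 : rk w = 2 * T.rank w := by simp [rk, h1, h2]
            rw [e1, e2]; omega
          · have h4 : T.parent w ≠ v := fun h => hv (h ▸ T.parent_mem w hw' hwr)
            have := hrk _ hp h4
            simp [pa, rk, h1, h2, hp, this, h3] }
    refine ⟨T', rfl, ?_⟩
    change ∑ w ∈ (insert v T.verts).erase r, c w (pa w) ≤ _
    have huE : u ∈ T.verts.erase r := Finset.mem_erase.2 ⟨hur, hu⟩
    rw [RootedTree.cost, Finset.erase_insert_of_ne hvr, Finset.sum_insert (by simp [hv]),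
      ← Finset.add_sum_erase _ _ huE, ← Finset.add_sum_erase _ _ huE, ← add_assoc]
    have hfirst : c v (pa v) + c u (pa u) = contractLen c u v u (T.parent u) := by
      rw [← hq]
      have h1 : c (cl q) q = min (c u q) (c v q) := by rw [← hcl q, hsymm]
      have h2 : c ot (cl q) = 0 := by
        rcases hcases with ⟨h3, h4⟩ | ⟨h3, h4⟩ <;> rw [h3, h4]
        · rw [hsymm, h0]
        · exact h0
      have h3 : c (cl q) (pa (cl q)) + c ot (pa ot) = min (c u q) (c v q) := by
        simp [pa, hotne, h1, h2]
      rw [contractLen, if_pos rfl, ← h3]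
      rcases hcases with ⟨h3, h4⟩ | ⟨h3, h4⟩ <;> rw [h3, h4]
      ring
    rw [hfirst]
    refine add_le_add le_rfl (Finset.sum_le_sum fun w hw => ?_)
    have hwu := Finset.ne_of_mem_erase hw
    have hw1 := Finset.mem_of_mem_erase (Finset.mem_of_mem_erase hw)
    have hwv : w ≠ v := fun h => hv (h ▸ hw1)
    have := hrk w hwu hwv
    by_cases hp : T.parent w = u
    · simp only [pa, this.1, this.2, hp, hwu, if_true, if_false, contractLen, hcl]
      rw [hsymm w u, hsymm w v]
    · simp [pa, this.1, this.2, hp, hwu, contractLen]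

end

/-! ### Prize-collecting trees by the primal-dual method -/

section

variable {V : Type u} [DecidableEq V] {r : V}

/-- A tree with `c(T) + 2 π(W \ T) ≤ c(x) + 2 ∑ π_v (1 - y_v)` exists (sums over unordered pairs are
written as halves of sums over ordered pairs). -/
def HasCheapTree (r : V) (W : Finset V) (c : V → V → ℝ) (π : V → ℝ) (x : V → V → ℝ) (y : V → ℝ) :
    Prop :=
  ∃ T : RootedTree V r, T.verts ⊆ W ∧
    T.cost c + 2 * ∑ v ∈ W \ T.verts, π v ≤
      (∑ u ∈ W, ∑ v ∈ W, c u v * x u v) / 2 + 2 * ∑ v ∈ W.erase r, π v * (1 - y v)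

/-- The data of a relaxed prize-collecting Steiner tree instance on the vertex set `W`, together
with a fractional solution `(x, y)` of its cut relaxation. -/
structure IsCutSolution (r : V) (W : Finset V) (c : V → V → ℝ) (π : V → ℝ) (x : V → V → ℝ)
    (y : V → ℝ) : Prop where
  root_mem : r ∈ W
  len_symm : ∀ u v, c u v = c v u
  len_nonneg : ∀ u ∈ W, ∀ v ∈ W, u ≠ v → 0 ≤ c u v
  pen_nonneg : ∀ v ∈ W.erase r, 0 ≤ π v
  symm : ∀ u v, x u v = x v u
  nonneg : ∀ u v, 0 ≤ x u v
  diag : ∀ v, x v v = 0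
  le_one : ∀ v ∈ W.erase r, y v ≤ 1
  cut : ∀ S ⊆ W.erase r, ∀ v ∈ S, 2 * y v ≤ ∑ a ∈ S, ∑ b ∈ W \ S, x a b

theorem IsCutSolution.contract {W : Finset V} {c : V → V → ℝ} {π : V → ℝ} {x : V → V → ℝ}
    {y : V → ℝ} (h : IsCutSolution r W c π x y) {u v : V} (huW : u ∈ W) (hvW : v ∈ W) (huv : u ≠ v)
    (hvr : v ≠ r) :
    IsCutSolution r (W.erase v) (contractLen c u v) (Function.update π u (π u + π v))
      (contractWeight x u v) (Function.update y u (max (y u) (y v))) := by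
  have hxs := h.symm
  have hcs := h.len_symm
  refine ⟨Finset.mem_erase.2 ⟨hvr.symm, h.root_mem⟩, ?_, ?_, ?_, ?_, ?_, ?_, ?_, ?_⟩
  · intro a b
    unfold contractLen
    split_ifs with h1 h2 h2
    · rw [h1, h2]
    · rw [hcs u b, hcs v b]
    · rw [hcs a u, hcs a v]
    · exact hcs a b
  · intro a ha b hb hab
    obtain ⟨hav, haW⟩ := Finset.mem_erase.1 ha
    obtain ⟨hbv, hbW⟩ := Finset.mem_erase.1 hb
    unfold contractLen
    split_ifs with h1 h2
    · exact le_min (h.len_nonneg _ huW _ hbW (h1 ▸ hab)) (h.len_nonneg _ hvW _ hbW hbv.symm)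
    · exact le_min (h.len_nonneg _ haW _ huW h1) (h.len_nonneg _ haW _ hvW hav)
    · exact h.len_nonneg _ haW _ hbW hab
  · intro a ha
    obtain ⟨har, ha⟩ := Finset.mem_erase.1 ha
    have haW := Finset.mem_of_mem_erase ha
    by_cases hau : a = u
    · subst hau
      simp only [Function.update_self]
      exact add_nonneg (h.pen_nonneg _ (Finset.mem_erase.2 ⟨har, haW⟩))
        (h.pen_nonneg _ (Finset.mem_erase.2 ⟨hvr, hvW⟩))
    · simp only [Function.update_of_ne hau]
      exact h.pen_nonneg _ (Finset.mem_erase.2 ⟨har, haW⟩)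
  · intro a b
    unfold contractWeight
    by_cases hab : a = b
    · simp [hab]
    · rw [if_neg hab, if_neg (Ne.symm hab), hxs a b, hxs v b, hxs a v]; ring
  · intro a b
    unfold contractWeight
    have := h.nonneg
    split_ifs <;> simp [this, add_nonneg]
  · intro a
    simp [contractWeight]
  · intro a ha
    obtain ⟨har, ha⟩ := Finset.mem_erase.1 ha
    have haW := Finset.mem_of_mem_erase ha
    by_cases hau : a = u
    · subst hau
      simp only [Function.update_self]
      exact max_le (h.le_one _ (Finset.mem_erase.2 ⟨har, haW⟩))
        (h.le_one _ (Finset.mem_erase.2 ⟨hvr, hvW⟩))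
    · simp only [Function.update_of_ne hau]
      exact h.le_one _ (Finset.mem_erase.2 ⟨har, haW⟩)
  · intro S hS w hw
    have hSv : v ∉ S := fun hv => by simpa using hS hv
    have hSr : r ∉ S := fun hv => by simpa using hS hv
    have hSW : S ⊆ W := fun a ha => Finset.mem_of_mem_erase (Finset.mem_of_mem_erase (hS ha))
    by_cases huS : u ∈ S
    · have key : ∑ a ∈ S, ∑ b ∈ W.erase v \ S, contractWeight x u v a b
          = ∑ a ∈ insert v S, ∑ b ∈ W \ insert v S, x a b := by
        have e : W.erase v \ S = W \ insert v S := by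
          ext b; simp only [Finset.mem_sdiff, Finset.mem_erase, Finset.mem_insert]; tauto
        rw [e, Finset.sum_insert hSv]
        have : ∀ a ∈ S, ∑ b ∈ W \ insert v S, contractWeight x u v a b
            = ∑ b ∈ W \ insert v S, x a b + if a = u then ∑ b ∈ W \ insert v S, x v b else 0 := by
          intro a ha
          have e2 : ∀ b ∈ W \ insert v S, contractWeight x u v a b
              = x a b + if a = u then x v b else 0 := by
            intro b hb
            have hbS : b ∉ S := fun hb' => by simp [hb'] at hb
            have h1 : a ≠ b := fun e => hbS (e ▸ ha)
            have h2 : b ≠ u := fun e => hbS (e ▸ huS)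
            simp [contractWeight, h1, h2]
          rw [Finset.sum_congr rfl e2, Finset.sum_add_distrib]
          split_ifs <;> simp
        rw [Finset.sum_congr rfl this, Finset.sum_add_distrib, Finset.sum_ite_eq' S u]
        simp [huS, add_comm]
      rw [key]
      have hsub : insert v S ⊆ W.erase r := by
        intro a ha
        rcases Finset.mem_insert.1 ha with rfl | ha
        · exact Finset.mem_erase.2 ⟨hvr, hvW⟩
        · exact Finset.mem_erase.2 ⟨fun e => hSr (e ▸ ha), hSW ha⟩
      by_cases hwu : w = u
      · subst hwu
        rw [Function.update_self]
        have h1 := h.cut _ hsub w (Finset.mem_insert_of_mem hw)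
        have h2 := h.cut _ hsub v (Finset.mem_insert_self _ _)
        rcases max_cases (y w) (y v) with h3 | h3 <;> rw [h3.1] <;> assumption
      · rw [Function.update_of_ne hwu]
        exact h.cut _ hsub w (Finset.mem_insert_of_mem hw)
    · have key : ∑ a ∈ S, ∑ b ∈ W.erase v \ S, contractWeight x u v a b
          = ∑ a ∈ S, ∑ b ∈ W \ S, x a b := by
        apply Finset.sum_congr rfl
        intro a ha
        have hvm : v ∈ W \ S := Finset.mem_sdiff.2 ⟨hvW, hSv⟩
        have e : W.erase v \ S = (W \ S).erase v := by
          ext b; simp only [Finset.mem_sdiff, Finset.mem_erase]; tauto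
        have e2 : ∀ b ∈ (W \ S).erase v, contractWeight x u v a b
            = x a b + if b = u then x a v else 0 := by
          intro b hb
          have hbS : b ∉ S := fun hb' => by simp [hb'] at hb
          have h1 : a ≠ b := fun e => hbS (e ▸ ha)
          have h2 : a ≠ u := fun e => huS (e ▸ ha)
          simp [contractWeight, h1, h2]
        rw [e, Finset.sum_congr rfl e2, Finset.sum_add_distrib, Finset.sum_ite_eq' _ u,
          if_pos (by simp [huv, huW, huS]), Finset.sum_erase_add _ _ hvm]
      rw [key]
      have hsub : S ⊆ W.erase r := fun a ha =>
        Finset.mem_erase.2 ⟨fun e => hSr (e ▸ ha), hSW ha⟩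
      have hwu : w ≠ u := fun e => huS (e ▸ hw)
      rw [Function.update_of_ne hwu]
      exact h.cut _ hsub w hw

/-- A cheap tree after contracting an edge of length `0` yields a cheap tree. -/
theorem HasCheapTree.of_contract {W : Finset V} {c : V → V → ℝ} {π : V → ℝ} {x : V → V → ℝ}
    {y : V → ℝ} (h : IsCutSolution r W c π x y) {u v : V} (huW : u ∈ W) (hvW : v ∈ W) (huv : u ≠ v)
    (hvr : v ≠ r) (h0 : c u v = 0)
    (hT : HasCheapTree r (W.erase v) (contractLen c u v) (Function.update π u (π u + π v))
      (contractWeight x u v) (Function.update y u (max (y u) (y v)))) :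
    HasCheapTree r W c π x y := by
  obtain ⟨T, hTW, hT⟩ := hT
  have hvT : v ∉ T.verts := fun hv => by simpa using hTW hv
  have huW' : u ∈ W.erase v := Finset.mem_erase.2 ⟨huv, huW⟩
  have hxs := h.symm
  have hcs := h.len_symm
  have hx0 := h.nonneg
  -- the fractional length does not increase
  have hlen : ∑ a ∈ W.erase v, ∑ b ∈ W.erase v, contractLen c u v a b * contractWeight x u v a b
      ≤ ∑ a ∈ W, ∑ b ∈ W, c a b * x a b := by
    have e1 : ∑ a ∈ W, ∑ b ∈ W, c a b * x a b
        = ∑ a ∈ W.erase v, ∑ b ∈ W.erase v, c a b * x a b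
          + ∑ b ∈ W.erase v, c v b * x v b + ∑ a ∈ W.erase v, c a v * x a v := by
      rw [← Finset.sum_erase_add _ _ hvW, ← Finset.sum_erase_add W _ hvW, h.diag v,
        Finset.sum_congr rfl (fun a _ => (Finset.sum_erase_add W (fun b => c a b * x a b) hvW).symm),
        Finset.sum_add_distrib]
      ring
    have e2 : ∀ a ∈ W.erase v, ∀ b ∈ W.erase v,
        contractLen c u v a b * contractWeight x u v a b ≤
          c a b * x a b + (if a = u then c v b * x v b else 0)
            + (if b = u then c a v * x a v else 0) := by
      intro a ha b hb
      obtain ⟨hav, haW⟩ := Finset.mem_erase.1 ha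
      obtain ⟨hbv, hbW⟩ := Finset.mem_erase.1 hb
      by_cases hab : a = b
      · subst hab
        simp only [contractWeight, if_true, mul_zero, h.diag a]
        by_cases hau : a = u
        · have h1 := mul_nonneg (h.len_nonneg v hvW a haW hav.symm) (hx0 v a)
          have h2 := mul_nonneg (h.len_nonneg a haW v hvW hav) (hx0 a v)
          simp only [hau, if_true] at *
          linarith
        · simp [hau]
      · by_cases hau : a = u
        · have hbu : b ≠ u := fun e => hab (hau.trans e.symm)
          subst hau
          simp only [contractWeight, contractLen, hab, hbu, if_true, if_false, add_zero]
          have h1 := mul_le_mul_of_nonneg_right (min_le_left (c a b) (c v b)) (hx0 a b)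
          have h2 := mul_le_mul_of_nonneg_right (min_le_right (c a b) (c v b)) (hx0 v b)
          rw [mul_add]; linarith
        · by_cases hbu : b = u
          · subst hbu
            simp only [contractWeight, contractLen, hau, if_true, if_false, add_zero]
            have h1 := mul_le_mul_of_nonneg_right (min_le_left (c a b) (c a v)) (hx0 a b)
            have h2 := mul_le_mul_of_nonneg_right (min_le_right (c a b) (c a v)) (hx0 a v)
            rw [mul_add]; linarith
          · simp [contractWeight, contractLen, hau, hbu, hab]
    refine (Finset.sum_le_sum fun a ha => Finset.sum_le_sum fun b hb => e2 a ha b hb).trans ?_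
    rw [e1]
    simp only [Finset.sum_add_distrib, Finset.sum_ite_eq', huW', if_true]
    have : ∑ a ∈ W.erase v, ∑ b ∈ W.erase v, (if a = u then c v b * x v b else 0)
        = ∑ b ∈ W.erase v, c v b * x v b := by
      rw [Finset.sum_comm]
      simp only [Finset.sum_ite_eq', huW', if_true]
    rw [this]
  -- neither do the fractional penalties
  have hpen : ∑ w ∈ (W.erase v).erase r,
        Function.update π u (π u + π v) w * (1 - Function.update y u (max (y u) (y v)) w)
      ≤ ∑ w ∈ W.erase r, π w * (1 - y w) := by
    have hvE : v ∈ W.erase r := Finset.mem_erase.2 ⟨hvr, hvW⟩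
    have hv0 := mul_nonneg (h.pen_nonneg v hvE) (sub_nonneg.2 (h.le_one v hvE))
    rw [Finset.erase_right_comm, ← Finset.sum_erase_add _ _ hvE]
    by_cases hur : u = r
    · refine (Finset.sum_le_sum fun w hw => ?_).trans (le_add_of_nonneg_right hv0)
      have : w ≠ u := fun e => by simp [e, hur] at hw
      rw [Function.update_of_ne this, Function.update_of_ne this]
    · have huE : u ∈ W.erase r := Finset.mem_erase.2 ⟨hur, huW⟩
      have huE' : u ∈ (W.erase r).erase v := Finset.mem_erase.2 ⟨huv, huE⟩
      rw [← Finset.sum_erase_add _ _ huE', ← Finset.sum_erase_add _ _ huE', add_assoc]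
      refine add_le_add (Finset.sum_le_sum fun w hw => ?_) ?_
      · have : w ≠ u := Finset.ne_of_mem_erase hw
        rw [Function.update_of_ne this, Function.update_of_ne this]
      · rw [Function.update_self, Function.update_self, add_mul]
        have h1 := h.pen_nonneg u huE
        have h2 := h.pen_nonneg v hvE
        have h3 := le_max_left (y u) (y v)
        have h4 := le_max_right (y u) (y v)
        exact add_le_add (mul_le_mul_of_nonneg_left (by linarith) h1)
          (mul_le_mul_of_nonneg_left (by linarith) h2)
  by_cases huT : u ∈ T.verts
  · obtain ⟨T', hT'v, hT'c⟩ := T.exists_lift c hcs huv hvr h0 hvT huT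
    have hW : W \ T'.verts = W.erase v \ T.verts := by
      ext b; simp only [hT'v, Finset.mem_sdiff, Finset.mem_erase, Finset.mem_insert]; tauto
    have hp : ∑ w ∈ W.erase v \ T.verts, Function.update π u (π u + π v) w
        = ∑ w ∈ W \ T'.verts, π w := by
      rw [hW]
      refine Finset.sum_congr rfl fun w hw => ?_
      have : w ≠ u := fun e => by simp [e, huT] at hw
      rw [Function.update_of_ne this]
    refine ⟨T', ?_, ?_⟩
    · rw [hT'v]
      exact Finset.insert_subset hvW (hTW.trans (Finset.erase_subset _ _))
    · rw [hp] at hT; linarith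
  · have hur : u ≠ r := fun e => huT (e ▸ T.root_mem)
    have hp : ∑ w ∈ W.erase v \ T.verts, Function.update π u (π u + π v) w
        = ∑ w ∈ W \ T.verts, π w := by
      have e : W.erase v \ T.verts = (W \ T.verts).erase v := by
        ext b; simp only [Finset.mem_sdiff, Finset.mem_erase]; tauto
      have h1 : v ∈ W \ T.verts := Finset.mem_sdiff.2 ⟨hvW, hvT⟩
      have h2 : u ∈ (W \ T.verts).erase v := by simp [huv, huW, huT]
      rw [e, ← Finset.sum_erase_add _ _ h1, ← Finset.sum_erase_add _ _ h2,
        ← Finset.sum_erase_add _ _ h2, Function.update_self, add_assoc]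
      congr 1
      refine Finset.sum_congr rfl fun w hw => ?_
      rw [Function.update_of_ne (Finset.ne_of_mem_erase hw)]
    have hcost : T.cost c = T.cost (contractLen c u v) := by
      refine Finset.sum_congr rfl fun w hw => ?_
      obtain ⟨hwr, hw⟩ := Finset.mem_erase.1 hw
      have h1 : w ≠ u := fun e => huT (e ▸ hw)
      have h2 : T.parent w ≠ u := fun e => huT (e ▸ T.parent_mem w hw hwr)
      simp [contractLen, h1, h2]
    refine ⟨T, hTW.trans (Finset.erase_subset _ _), ?_⟩
    rw [hp] at hT; rw [hcost]; linarith

/-- If every tree vertex outside `A` other than the root has a child, then the number of edge ends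
in `A` is at most twice the number of tree vertices in `A`: the vertices outside `A` have at least as
many children as there are of them, which leaves at most one child on average for those in `A`. -/
theorem RootedTree.sum_ends_le (T : RootedTree V r) (A : Finset V) (hA : r ∉ A)
    (hleaf : ∀ v ∈ T.verts, v ≠ r → v ∉ A → ∃ w ∈ T.verts.erase r, T.parent w = v) {δ : ℝ}
    (hδ : 0 ≤ δ) :
    ∑ v ∈ T.verts.erase r, ((if v ∈ A then δ else 0) + (if T.parent v ∈ A then δ else 0))
      ≤ 2 * δ * (T.verts ∩ A).card := by
  set E := T.verts.erase r with hE
  have h1 : (E.filter (· ∉ A)).card ≤ (E.filter (T.parent · ∉ A)).card := by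
    refine (Finset.card_le_card (t := (E.filter (T.parent · ∉ A)).image T.parent) ?_).trans
      Finset.card_image_le
    intro v hv
    obtain ⟨hvE, hvA⟩ := Finset.mem_filter.1 hv
    obtain ⟨hvr, hvT⟩ := Finset.mem_erase.1 hvE
    obtain ⟨w, hw, rfl⟩ := hleaf v hvT hvr hvA
    exact Finset.mem_image_of_mem _ (Finset.mem_filter.2 ⟨hw, hvA⟩)
  have h2 := Finset.card_filter_add_card_filter_not (s := E) (· ∈ A)
  have h3 := Finset.card_filter_add_card_filter_not (s := E) (T.parent · ∈ A)
  have h4 : E.filter (· ∈ A) = T.verts ∩ A := by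
    ext v
    simp only [hE, Finset.mem_filter, Finset.mem_erase, Finset.mem_inter]
    constructor
    · tauto
    · exact fun h => ⟨⟨fun e => hA (e ▸ h.2), h.1⟩, h.2⟩
  have h5 : ((E.filter (T.parent · ∈ A)).card : ℝ) ≤ (T.verts ∩ A).card := by
    rw [h4] at h2
    exact_mod_cast (by omega : (E.filter (T.parent · ∈ A)).card ≤ (T.verts ∩ A).card)
  rw [Finset.sum_add_distrib, ← Finset.sum_filter, ← Finset.sum_filter, h4]
  simp only [Finset.sum_const, nsmul_eq_mul]
  nlinarith

/-- Raising the dual variables of all singletons in `A` by `δ`: a cheap tree for the reduced lengths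
and penalties is, once pruned, cheap for the original ones. -/
theorem HasCheapTree.of_grow {W : Finset V} {c : V → V → ℝ} {π : V → ℝ} {x : V → V → ℝ}
    {y : V → ℝ} (h : IsCutSolution r W c π x y) {A : Finset V} (hAW : A ⊆ W.erase r)
    (hA : ∀ v ∈ W.erase r, v ∉ A → π v = 0) {δ : ℝ} (hδ : 0 ≤ δ)
    (hc : ∀ u ∈ W, ∀ v ∈ W, u ≠ v →
      0 ≤ c u v - ((if u ∈ A then δ else 0) + (if v ∈ A then δ else 0)))
    (hT : HasCheapTree r W
      (fun u v => c u v - ((if u ∈ A then δ else 0) + (if v ∈ A then δ else 0)))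
      (fun v => π v - if v ∈ A then δ else 0) x y) :
    HasCheapTree r W c π x y := by
  obtain ⟨T₀, hT₀W, hT₀⟩ := hT
  obtain ⟨T, hTW, hT, hleaf⟩ := T₀.exists_pruned _
    (fun v => π v - if v ∈ A then δ else 0) W hc _ rfl hT₀W
  have hrA : r ∉ A := fun hr => by simpa using hAW hr
  have hAW' : A ⊆ W := hAW.trans (Finset.erase_subset _ _)
  refine ⟨T, hTW, ?_⟩
  have hends := T.sum_ends_le A hrA (fun v hv hvr hvA => hleaf v hv hvr (by
    simp [hvA, hA v (Finset.mem_erase.2 ⟨hvr, hTW hv⟩) hvA])) hδ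
  have h1 := hT.trans hT₀
  have e1 : T.cost (fun u v => c u v - ((if u ∈ A then δ else 0) + (if v ∈ A then δ else 0)))
      = T.cost c - ∑ v ∈ T.verts.erase r,
        ((if v ∈ A then δ else 0) + (if T.parent v ∈ A then δ else 0)) := by
    simp only [RootedTree.cost, Finset.sum_sub_distrib]
  have e2 : ∑ v ∈ W \ T.verts, (π v - if v ∈ A then δ else 0)
      = ∑ v ∈ W \ T.verts, π v - δ * (A \ T.verts).card := by
    rw [Finset.sum_sub_distrib, ← Finset.sum_filter, Finset.sum_const, nsmul_eq_mul]
    have : (W \ T.verts).filter (· ∈ A) = A \ T.verts := by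
      ext v; simp only [Finset.mem_filter, Finset.mem_sdiff]
      exact ⟨fun h => ⟨h.2, h.1.2⟩, fun h => ⟨⟨hAW' h.1, h.2⟩, h.1⟩⟩
    rw [this]; ring
  have e3 : ∑ v ∈ W.erase r, (π v - if v ∈ A then δ else 0) * (1 - y v)
      = ∑ v ∈ W.erase r, π v * (1 - y v) - δ * ∑ v ∈ A, (1 - y v) := by
    have : ∀ v ∈ W.erase r, (π v - if v ∈ A then δ else 0) * (1 - y v)
        = π v * (1 - y v) - if v ∈ A then δ * (1 - y v) else 0 := by
      intro v _; split_ifs <;> ring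
    rw [Finset.sum_congr rfl this, Finset.sum_sub_distrib, ← Finset.sum_filter,
      Finset.filter_mem_eq_inter, Finset.inter_eq_right.2 hAW, Finset.mul_sum]
  have e4 : ∑ u ∈ W, ∑ v ∈ W,
        (c u v - ((if u ∈ A then δ else 0) + (if v ∈ A then δ else 0))) * x u v
      = ∑ u ∈ W, ∑ v ∈ W, c u v * x u v - 2 * (δ * ∑ u ∈ A, ∑ v ∈ W, x u v) := by
    have hrow : ∑ u ∈ W, ∑ v ∈ W, (if u ∈ A then δ else 0) * x u v
        = δ * ∑ u ∈ A, ∑ v ∈ W, x u v := by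
      have : ∀ u ∈ W, ∑ v ∈ W, (if u ∈ A then δ else 0) * x u v
          = if u ∈ A then δ * ∑ v ∈ W, x u v else 0 := by
        intro u _
        rw [← Finset.mul_sum]; split_ifs <;> simp
      rw [Finset.sum_congr rfl this, ← Finset.sum_filter, Finset.filter_mem_eq_inter,
        Finset.inter_eq_right.2 hAW', Finset.mul_sum]
    have hcol : ∑ u ∈ W, ∑ v ∈ W, (if v ∈ A then δ else 0) * x u v
        = δ * ∑ u ∈ A, ∑ v ∈ W, x u v := by
      rw [Finset.sum_comm, ← hrow]
      simp only [h.symm]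
    simp only [sub_mul, add_mul, Finset.sum_sub_distrib, Finset.sum_add_distrib, hrow, hcol]
    ring
  have e5 : ∑ v ∈ A, (2 * y v) ≤ ∑ u ∈ A, ∑ v ∈ W, x u v := by
    refine Finset.sum_le_sum fun v hv => ?_
    have := h.cut {v} (Finset.singleton_subset_iff.2 (hAW hv)) v (Finset.mem_singleton_self v)
    rw [Finset.sum_singleton] at this
    exact this.trans (Finset.sum_le_sum_of_subset_of_nonneg Finset.sdiff_subset
      fun _ _ _ => h.nonneg _ _)
  have e6 : (T.verts ∩ A).card + (A \ T.verts).card = A.card := by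
    rw [Finset.inter_comm, Finset.card_inter_add_card_sdiff]
  have e6' : ((T.verts ∩ A).card : ℝ) + (A \ T.verts).card = A.card := by exact_mod_cast e6
  rw [e1, e2, e3, e4] at h1
  rw [Finset.sum_sub_distrib, Finset.sum_const, nsmul_eq_mul, mul_one] at h1
  rw [← Finset.mul_sum] at e5
  nlinarith

/-- Goemans and Williamson's bound for prize-collecting Steiner trees. The proof is their primal-dual
algorithm, as an induction: contract an edge of length `0` if there is one, and otherwise grow all
vertices of positive penalty until a length or a penalty vanishes. -/
theorem IsCutSolution.hasCheapTree : ∀ (n : ℕ) {W : Finset V} {c : V → V → ℝ} {π : V → ℝ}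
    {x : V → V → ℝ} {y : V → ℝ}, IsCutSolution r W c π x y →
    2 * W.card + ((W.erase r).filter (0 < π ·)).card = n → HasCheapTree r W c π x y := by
  intro n
  induction n using Nat.strong_induction_on with
  | _ n ih =>
  intro W c π x y h hn
  -- contraction of an edge of length zero
  have hzero : ∀ (c' : V → V → ℝ) (π' : V → ℝ), IsCutSolution r W c' π' x y →
      ((W.erase r).filter (0 < π' ·)).card ≤ ((W.erase r).filter (0 < π ·)).card →
      (∃ u ∈ W, ∃ v ∈ W, u ≠ v ∧ c' u v = 0) → HasCheapTree r W c' π' x y := by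
    intro c' π' h' hle ⟨u, hu, v, hv, huv, h0⟩
    wlog hvr : v ≠ r generalizing u v
    · exact this v hv u hu huv.symm (by rw [h'.len_symm, h0])
        (fun e => huv (e.trans (not_not.1 hvr).symm))
    refine HasCheapTree.of_contract h' hu hv huv hvr h0 (ih _ ?_ (h'.contract hu hv huv hvr) rfl)
    have hsub : ((W.erase v).erase r).filter (0 < Function.update π' u (π' u + π' v) ·)
        ⊆ insert u ((W.erase r).filter (0 < π' ·)) := by
      intro w hw
      simp only [Finset.mem_filter, Finset.mem_erase, Finset.mem_insert] at hw ⊢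
      by_cases hwu : w = u
      · exact Or.inl hwu
      · rw [Function.update_of_ne hwu] at hw; tauto
    have h1 := (Finset.card_le_card hsub).trans (Finset.card_insert_le _ _)
    have h2 := Finset.card_erase_add_one hv
    omega
  by_cases hz : ∃ u ∈ W, ∃ v ∈ W, u ≠ v ∧ c u v = 0
  · exact hzero c π h le_rfl hz
  set A := (W.erase r).filter (0 < π ·) with hAdef
  have hAW : A ⊆ W.erase r := Finset.filter_subset _ _
  have hA0 : ∀ v ∈ W.erase r, v ∉ A → π v = 0 := by
    intro v hv hvA
    by_contra hne
    exact hvA (Finset.mem_filter.2 ⟨hv, lt_of_le_of_ne (h.pen_nonneg v hv) (Ne.symm hne)⟩)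
  rcases A.eq_empty_or_nonempty with hAe | hAne
  · -- no penalties: take the root only
    have hall : ∀ v ∈ W.erase r, π v = 0 := fun v hv => hA0 v hv (by simp [hAe])
    refine ⟨⟨{r}, id, fun _ => 0, Finset.mem_singleton_self r, by simp, by simp⟩, by
      simpa using h.root_mem, ?_⟩
    have e1 : ∑ v ∈ W \ {r}, π v = 0 :=
      Finset.sum_eq_zero fun v hv => hall v (by simpa [and_comm] using hv)
    have e2 : ∑ v ∈ W.erase r, π v * (1 - y v) = 0 :=
      Finset.sum_eq_zero fun v hv => by rw [hall v hv, zero_mul]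
    have e3 : 0 ≤ ∑ u ∈ W, ∑ v ∈ W, c u v * x u v := by
      refine Finset.sum_nonneg fun u hu => Finset.sum_nonneg fun v hv => ?_
      by_cases huv : u = v
      · simp [huv, h.diag]
      · exact mul_nonneg (h.len_nonneg u hu v hv huv) (h.nonneg u v)
    simp only [RootedTree.cost, e1, e2]
    simp; linarith
  -- the time `δ` of the first event
  obtain ⟨v₀, hv₀, hv₀min⟩ := A.exists_min_image π hAne
  let P := (A ×ˢ W).filter fun e => e.1 ≠ e.2
  have hPne : P.Nonempty := by
    refine ⟨(v₀, r), Finset.mem_filter.2 ⟨Finset.mem_product.2 ⟨hv₀, h.root_mem⟩, ?_⟩⟩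
    exact Finset.ne_of_mem_erase (hAW hv₀)
  obtain ⟨e₀, he₀, he₀min⟩ :=
    P.exists_min_image (fun e => c e.1 e.2 / if e.2 ∈ A then 2 else 1) hPne
  set δ := min (π v₀) (c e₀.1 e₀.2 / if e₀.2 ∈ A then 2 else 1) with hδdef
  have hP : ∀ e ∈ P, e.1 ∈ A ∧ e.1 ∈ W ∧ e.2 ∈ W ∧ e.1 ≠ e.2 := by
    intro e he
    obtain ⟨h1, h2⟩ := Finset.mem_filter.1 he
    obtain ⟨h3, h4⟩ := Finset.mem_product.1 h1
    exact ⟨h3, Finset.mem_of_mem_erase (hAW h3), h4, h2⟩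
  have hcpos : ∀ u ∈ W, ∀ v ∈ W, u ≠ v → 0 < c u v := fun u hu v hv huv =>
    lt_of_le_of_ne (h.len_nonneg u hu v hv huv) fun e => hz ⟨u, hu, v, hv, huv, e.symm⟩
  obtain ⟨k1, k2, k3, k4⟩ := hP e₀ he₀
  have hδ : 0 < δ := by
    refine lt_min (Finset.mem_filter.1 hv₀).2 ?_
    have := hcpos _ k2 _ k3 k4
    split_ifs <;> linarith
  have hpair : ∀ u ∈ A, ∀ v ∈ W, u ≠ v → δ + (if v ∈ A then δ else 0) ≤ c u v := by
    intro u hu v hv huv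
    have h1 := he₀min (u, v) (Finset.mem_filter.2 ⟨Finset.mem_product.2 ⟨hu, hv⟩, huv⟩)
    have h2 : δ ≤ c u v / if v ∈ A then 2 else 1 := (min_le_right _ _).trans h1
    split_ifs with hvA
    · rw [if_pos hvA] at h2; linarith
    · rw [if_neg hvA] at h2; linarith
  have hc' : ∀ u ∈ W, ∀ v ∈ W, u ≠ v →
      0 ≤ c u v - ((if u ∈ A then δ else 0) + (if v ∈ A then δ else 0)) := by
    intro u hu v hv huv
    by_cases huA : u ∈ A
    · have := hpair u huA v hv huv
      rw [if_pos huA]; linarith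
    · by_cases hvA : v ∈ A
      · have := hpair v hvA u hu huv.symm
        rw [if_neg huA] at this
        rw [if_pos hvA, if_neg huA, h.len_symm]; linarith
      · rw [if_neg huA, if_neg hvA]
        have := hcpos u hu v hv huv
        linarith
  have hπ' : ∀ v ∈ W.erase r, 0 ≤ π v - if v ∈ A then δ else 0 := by
    intro v hv
    split_ifs with hvA
    · have := (min_le_left _ _ : δ ≤ _).trans (hv₀min v hvA)
      linarith
    · have := h.pen_nonneg v hv
      linarith
  have hsol : IsCutSolution r W
      (fun u v => c u v - ((if u ∈ A then δ else 0) + (if v ∈ A then δ else 0)))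
      (fun v => π v - if v ∈ A then δ else 0) x y :=
    { h with
      len_symm := fun u v => by rw [h.len_symm u v, add_comm]
      len_nonneg := hc'
      pen_nonneg := hπ' }
  have hsub : (W.erase r).filter (fun v => 0 < π v - if v ∈ A then δ else 0) ⊆ A := by
    intro v hv
    obtain ⟨h1, h2⟩ := Finset.mem_filter.1 hv
    by_contra hvA
    rw [if_neg hvA, hA0 v h1 hvA] at h2
    simp at h2
  refine HasCheapTree.of_grow h hAW hA0 hδ.le hc' ?_
  rcases min_choice (π v₀) (c e₀.1 e₀.2 / if e₀.2 ∈ A then 2 else 1) with hm | hm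
  · -- a penalty vanishes
    refine ih _ ?_ hsol rfl
    have : ((W.erase r).filter (fun v => 0 < π v - if v ∈ A then δ else 0)).card < A.card := by
      refine Finset.card_lt_card (Finset.ssubset_iff_subset_ne.2 ⟨hsub, fun e => ?_⟩)
      have h1 : v₀ ∈ (W.erase r).filter (fun v => 0 < π v - if v ∈ A then δ else 0) := by
        rw [e]; exact hv₀
      have h2 := (Finset.mem_filter.1 h1).2
      rw [if_pos hv₀, hδdef, hm] at h2
      simp at h2
    omega
  · -- a length vanishes
    refine hzero _ _ hsol (Finset.card_le_card hsub) ⟨e₀.1, k2, e₀.2, k3, k4, ?_⟩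
    have h1 : δ = c e₀.1 e₀.2 / if e₀.2 ∈ A then 2 else 1 := hm
    simp only [k1, if_true]
    split_ifs at h1 ⊢ <;> linarith

end

/-! ### Perfect matchings and permutations -/

section

/-- The total weight of the pairs with exactly one element in `S`. -/
def cutWeight {V : Type u} [Fintype V] [DecidableEq V] (z : V → V → ℝ) (S : Finset V) : ℝ :=
  ∑ u ∈ S, ∑ v ∈ Sᶜ, z u v

/-- A perfect matching of the complete graph on `V`, as the map sending a vertex to its partner. -/
structure IsPerfectMatching {V : Type u} (M : V → V) : Prop where
  invol : ∀ v, M (M v) = v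
  ne : ∀ v, M v ≠ v

/-- A point of Edmonds' perfect matching polytope: all degrees are `1` and every odd cut has weight
at least `1`. -/
structure IsFractionalMatching {V : Type u} [Fintype V] [DecidableEq V] (z : V → V → ℝ) : Prop where
  symm : ∀ u v, z u v = z v u
  nonneg : ∀ u v, 0 ≤ z u v
  diag : ∀ v, z v v = 0
  degree : ∀ v, ∑ u, z v u = 1
  odd_cut : ∀ S : Finset V, Odd S.card → 1 ≤ cutWeight z S

section
variable {V : Type u} [Fintype V]

theorem exists_isPerfectMatching (hV : Even (Fintype.card V)) :
    ∃ M : V → V, IsPerfectMatching M := by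
  obtain ⟨m, hm⟩ := hV
  have e : V ≃ Fin m ⊕ Fin m := Fintype.equivOfCardEq (by simp [hm])
  refine ⟨fun v => e.symm (e v).swap, fun v => by simp, fun v h => ?_⟩
  have h2 : (e v).swap = e v := by rw [← Equiv.symm_apply_eq]; exact h
  cases h3 : e v <;> simp [h3] at h2

/-- A permutation all of whose cycles are even admits a proper 2-colouring of its cycles. -/
theorem exists_alternating_coloring (σ : Equiv.Perm V)
    (h : ∀ v, Even (Function.minimalPeriod σ v)) : ∃ col : V → Prop, ∀ v, col (σ v) ↔ ¬ col v := by
  let rep : V → V := fun v => Quotient.out (Quotient.mk (Equiv.Perm.SameCycle.setoid σ) v)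
  have hrep : ∀ v, σ.SameCycle (rep v) v := fun v =>
    Quotient.mk_out (s := Equiv.Perm.SameCycle.setoid σ) v
  have hrepσ : ∀ v, rep (σ v) = rep v := fun v => by
    have : Quotient.mk (Equiv.Perm.SameCycle.setoid σ) (σ v) = Quotient.mk _ v :=
      Quotient.sound (Equiv.Perm.sameCycle_apply_left.2 (Equiv.Perm.SameCycle.refl σ v))
    simp only [rep, this]
  have hpow : ∀ v, ∃ n : ℕ, (σ ^ n) (rep v) = v := fun v => by
    obtain ⟨n, -, h⟩ := (hrep v).exists_pow_eq' 
    exact ⟨n, h⟩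
  have hpar : ∀ (n m : ℕ) (v : V), (σ ^ n) v = (σ ^ m) v → (Even n ↔ Even m) := by
    have hle : ∀ n m : ℕ, m ≤ n → ∀ v, (σ ^ n) v = (σ ^ m) v → (Even n ↔ Even m) := by
      intro n m hmn v hnm
      have h1 : Function.IsPeriodicPt σ (n - m) v := by
        rw [Function.IsPeriodicPt, Function.IsFixedPt, Equiv.Perm.iterate_eq_pow]
        apply (σ ^ m).injective
        rw [← Equiv.Perm.mul_apply, ← pow_add, Nat.add_sub_cancel' hmn, hnm]
      have h2 := (h v).two_dvd.trans h1.minimalPeriod_dvd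
      rw [Nat.even_iff, Nat.even_iff]
      omega
    intro n m v hnm
    rcases le_total m n with h1 | h1
    · exact hle n m h1 v hnm
    · exact (hle m n h1 v hnm.symm).symm
  choose k hk using hpow
  refine ⟨fun v => Even (k v), fun v => ?_⟩
  have h1 : (σ ^ (k (σ v))) (rep v) = (σ ^ (k v + 1)) (rep v) := by
    have := hk (σ v)
    rw [hrepσ] at this
    rw [this, pow_succ', Equiv.Perm.mul_apply, hk v]
  exact (hpar _ _ _ h1).trans Nat.even_add_one

theorem exists_isPerfectMatching_of_even_cycles (σ : Equiv.Perm V) (hσ : ∀ v, σ v ≠ v)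
    (h : ∀ v, Even (Function.minimalPeriod σ v)) {c : V → V → ℝ} (hc : ∀ u v, c u v = c v u) :
    ∃ M : V → V, IsPerfectMatching M ∧ ∑ v, c v (M v) ≤ ∑ v, c v (σ v) := by
  classical
  -- one of the two alternating matchings is at most half as long as the union of the cycles
  have key : ∀ col : V → Prop, (∀ v, col (σ v) ↔ ¬ col v) →
      IsPerfectMatching (fun v => if col v then σ v else σ.symm v) := by
    intro col hcol
    have hcol' : ∀ v, col (σ.symm v) ↔ ¬ col v := fun v => by
      have := hcol (σ.symm v)
      rw [Equiv.apply_symm_apply] at this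
      tauto
    refine ⟨fun v => ?_, fun v hv => ?_⟩
    · by_cases hv : col v
      · simp [hv, hcol]
      · simp [hv, hcol']
    · by_cases hv' : col v
      · exact hσ v (by simpa [hv'] using hv)
      · simp only [hv', if_false] at hv
        exact hσ v (by rw [Equiv.symm_apply_eq] at hv; exact hv.symm)
  obtain ⟨col, hcol⟩ := exists_alternating_coloring σ h
  have h1 := key col hcol
  have h2 : IsPerfectMatching (fun v => if col v then σ.symm v else σ v) := by
    convert key (fun v => ¬ col v) (fun v => by rw [hcol]) using 2 with v
    by_cases hv : col v <;> simp [hv]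
  have hsum : ∑ v, c v (if col v then σ v else σ.symm v)
      + ∑ v, c v (if col v then σ.symm v else σ v) = 2 * ∑ v, c v (σ v) := by
    have e : ∑ v, c v (σ.symm v) = ∑ v, c v (σ v) := by
      rw [← Equiv.sum_comp σ]
      exact Finset.sum_congr rfl fun v _ => by rw [Equiv.symm_apply_apply, hc]
    rw [two_mul, ← Finset.sum_add_distrib]
    refine Eq.trans ?_ (congrArg (_ + ·) e)
    rw [← Finset.sum_add_distrib]
    refine Finset.sum_congr rfl fun v _ => ?_
    by_cases hv : col v <;> simp [hv, add_comm]
  by_cases hle : ∑ v, c v (if col v then σ v else σ.symm v) ≤ ∑ v, c v (σ v)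
  · exact ⟨_, h1, hle⟩
  · exact ⟨_, h2, by linarith⟩

variable [DecidableEq V]

theorem cutWeight_compl {z : V → V → ℝ} (hz : ∀ u v, z u v = z v u) (S : Finset V) :
    cutWeight z Sᶜ = cutWeight z S := by
  rw [cutWeight, cutWeight, Finset.sum_comm, compl_compl]
  simp only [hz]

theorem cutWeight_singleton {z : V → V → ℝ} (hd : ∀ v, z v v = 0) (v : V) :
    cutWeight z {v} = ∑ u, z v u := by
  rw [cutWeight, Finset.sum_singleton, ← Finset.sum_add_sum_compl {v}, Finset.sum_singleton, hd,
    zero_add]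

theorem exists_isPerfectMatching_apply (hV : Even (Fintype.card V)) {a b : V} (hab : a ≠ b) :
    ∃ M : V → V, IsPerfectMatching M ∧ M a = b := by
  obtain ⟨M, hM⟩ := exists_isPerfectMatching hV
  let τ := Equiv.swap (M a) b
  refine ⟨fun v => τ (M (τ v)), ⟨fun v => ?_, fun v h => ?_⟩, ?_⟩
  · simp [τ, hM.invol]
  · apply hM.ne (τ v)
    apply τ.injective
    simp only [h]; simp [τ]
  · have : τ a = a := Equiv.swap_apply_of_ne_of_ne (hM.ne a).symm hab
    simp only [this]; simp [τ]

/-- Birkhoff's theorem, in the form of an averaging argument: a fractional perfect matching dominates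
the length of a fixed-point-free permutation. -/
theorem IsFractionalMatching.exists_perm {z : V → V → ℝ} (hz : IsFractionalMatching z)
    (c : V → V → ℝ) :
    ∃ σ : Equiv.Perm V, (∀ v, σ v ≠ v) ∧ ∑ v, c v (σ v) ≤ ∑ u, ∑ v, c u v * z u v := by
  have hds : (Matrix.of z) ∈ doublyStochastic ℝ V := by
    rw [mem_doublyStochastic_iff_sum]
    exact ⟨hz.nonneg, hz.degree, fun j => by
      simpa [hz.symm _ j] using hz.degree j⟩
  obtain ⟨w, hw0, hw1, hw⟩ := exists_eq_sum_perm_of_mem_doublyStochastic hds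
  have hzw : ∀ u v, z u v = ∑ σ : Equiv.Perm V, if σ u = v then w σ else 0 := by
    intro u v
    have := congrFun (congrFun hw u) v
    rw [Matrix.sum_apply] at this
    simp only [Matrix.smul_apply, Equiv.Perm.permMatrix, PEquiv.toMatrix_apply,
      Equiv.toPEquiv_apply, Option.mem_def, Option.some.injEq, smul_eq_mul, mul_ite, mul_one,
      mul_zero, Matrix.of_apply] at this
    exact this.symm
  have hcost : ∑ u, ∑ v, c u v * z u v = ∑ σ : Equiv.Perm V, w σ * ∑ v, c v (σ v) := by
    simp only [hzw, Finset.mul_sum]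
    rw [Finset.sum_congr rfl fun u _ => Finset.sum_comm, Finset.sum_comm]
    refine Finset.sum_congr rfl fun σ _ => Finset.sum_congr rfl fun u _ => ?_
    simp [mul_comm]
  by_contra! hcon
  have hfix : ∀ σ, 0 < w σ → ∀ v, σ v ≠ v := by
    intro σ hσ v hv
    have h1 := hz.diag v
    rw [hzw] at h1
    have h2 := (Finset.sum_eq_zero_iff_of_nonneg (fun τ _ => by split_ifs <;> simp [hw0])).1 h1 σ
      (Finset.mem_univ _)
    rw [if_pos hv] at h2
    exact hσ.ne' h2
  have hpos : ∃ σ, 0 < w σ := by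
    by_contra! h
    have := Finset.sum_nonpos (fun σ (_ : σ ∈ Finset.univ) => h σ)
    linarith
  obtain ⟨σ₀, hσ₀⟩ := hpos
  have : ∑ σ, w σ * (∑ u, ∑ v, c u v * z u v) < ∑ σ : Equiv.Perm V, w σ * ∑ v, c v (σ v) := by
    refine Finset.sum_lt_sum (fun σ _ => ?_) ⟨σ₀, Finset.mem_univ _, ?_⟩
    · rcases (hw0 σ).eq_or_lt with h | h
      · simp [← h]
      · exact mul_le_mul_of_nonneg_left (hcon σ (hfix σ h)).le h.le
    · exact mul_lt_mul_of_pos_left (hcon σ₀ (hfix σ₀ hσ₀)) hσ₀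
  rw [← Finset.sum_mul, hw1, one_mul, ← hcost] at this
  exact lt_irrefl _ this

end

end

/-! ### Contracting one side of a tight odd cut -/

section

section
variable {V : Type u} [DecidableEq V]

/-- The map contracting the complement of `K` to the point `none`. -/
def collapse (K : Finset V) (v : V) : Option {v // v ∈ K} := if h : v ∈ K then some ⟨v, h⟩ else none

theorem collapse_of_mem {K : Finset V} {v : V} (h : v ∈ K) : collapse K v = some ⟨v, h⟩ := by
  simp [collapse, h]

theorem collapse_of_notMem {K : Finset V} {v : V} (h : v ∉ K) : collapse K v = none := by
  simp [collapse, h]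

variable [Fintype V]

/-- If a permutation without fixed points has an odd cycle, then moving from a fractional matching
towards (half of) the permutation makes an odd cut other than a vertex star tight. -/
theorem IsFractionalMatching.exists_tight_cut {z : V → V → ℝ} (hz : IsFractionalMatching z)
    (hV : Even (Fintype.card V)) {c : V → V → ℝ} (hc : ∀ u v, c u v = c v u) (σ : Equiv.Perm V)
    (hσ : ∀ v, σ v ≠ v) (hcost : ∑ v, c v (σ v) ≤ ∑ u, ∑ v, c u v * z u v) {v₀ : V}
    (hodd : Odd (Function.minimalPeriod σ v₀)) :
    ∃ z' : V → V → ℝ, IsFractionalMatching z' ∧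
      ∑ u, ∑ v, c u v * z' u v ≤ ∑ u, ∑ v, c u v * z u v ∧
      ∃ X : Finset V, Odd X.card ∧ cutWeight z' X = 1 ∧ 3 ≤ X.card ∧ 3 ≤ Xᶜ.card := by
  let s : V → V → ℝ := fun u v => ((if σ u = v then 1 else 0) + (if σ v = u then 1 else 0)) / 2
  have hs_symm : ∀ u v, s u v = s v u := fun u v => by simp only [s]; rw [add_comm]
  have hs_nonneg : ∀ u v, 0 ≤ s u v := fun u v => by simp only [s]; split_ifs <;> norm_num
  have hs_diag : ∀ v, s v v = 0 := fun v => by simp [s, hσ]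
  have hs_deg : ∀ v, ∑ u, s v u = 1 := fun v => by
    simp only [s, ← Finset.sum_div, Finset.sum_add_distrib, Finset.sum_ite_eq, Finset.mem_univ,
      if_true]
    have : ∀ u, (if σ u = v then (1 : ℝ) else 0) = if u = σ.symm v then 1 else 0 := fun u => by
      simp only [Equiv.eq_symm_apply]
    simp [this]
  have hs_cost : ∑ u, ∑ v, c u v * s u v = ∑ v, c v (σ v) := by
    have h1 : ∑ u, ∑ v, c u v * (if σ u = v then 1 else 0) = ∑ v, c v (σ v) := by simp
    have h2 : ∑ u, ∑ v, c u v * (if σ v = u then 1 else 0) = ∑ v, c v (σ v) := by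
      rw [Finset.sum_comm]; simp [hc _ (σ _)]
    have h3 : ∀ u v, c u v * s u v = (c u v * (if σ u = v then 1 else 0)
        + c u v * (if σ v = u then 1 else 0)) / 2 := fun u v => by simp only [s]; ring
    simp only [h3, ← Finset.sum_div, Finset.sum_add_distrib, h1, h2]
    ring
  -- the vertex set of the odd cycle
  let C : Finset V := (Finset.range (Function.minimalPeriod σ v₀)).image fun n => σ^[n] v₀
  have hC_card : C.card = Function.minimalPeriod σ v₀ := by
    rw [Finset.card_image_of_injOn, Finset.card_range]
    intro a ha b hb hab
    exact (Function.iterate_eq_iterate_iff_of_lt_minimalPeriod (by simpa using ha)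
      (by simpa using hb)).1 hab
  have hCσ : ∀ v, v ∈ C → σ v ∈ C := by
    intro v hv
    obtain ⟨n, -, rfl⟩ := Finset.mem_image.1 hv
    refine Finset.mem_image.2 ⟨(n + 1) % Function.minimalPeriod σ v₀, ?_, ?_⟩
    · exact Finset.mem_range.2 (Nat.mod_lt _ hodd.pos)
    · rw [Function.iterate_mod_minimalPeriod_eq, Function.iterate_succ_apply']
  have hCσ' : ∀ v, σ v ∈ C → v ∈ C := by
    have himg : C.image σ = C := Finset.eq_of_subset_of_card_le
      (Finset.image_subset_iff.2 hCσ) (Finset.card_image_of_injective _ σ.injective).ge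
    intro v hv
    rw [← himg] at hv
    obtain ⟨w, hw, e⟩ := Finset.mem_image.1 hv
    exact σ.injective e ▸ hw
  have hC_cut : cutWeight s C = 0 := by
    refine Finset.sum_eq_zero fun u hu => Finset.sum_eq_zero fun v hv => ?_
    have hv' : v ∉ C := by simpa using hv
    have h1 : σ u ≠ v := fun e => hv' (e ▸ hCσ u hu)
    have h2 : σ v ≠ u := fun e => hv' (hCσ' v (e ▸ hu))
    simp [s, h1, h2]
  -- the first point on the segment where one of the cuts violated by `s` becomes tight
  let F : Finset (Finset V) := Finset.univ.filter fun X => Odd X.card ∧ cutWeight s X < 1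
  have hCF : C ∈ F := by
    refine Finset.mem_filter.2 ⟨Finset.mem_univ _, by rwa [hC_card], by rw [hC_cut]; norm_num⟩
  obtain ⟨X, hXF, hXmin⟩ := F.exists_min_image
    (fun X => (cutWeight z X - 1) / (cutWeight z X - cutWeight s X)) ⟨C, hCF⟩
  obtain ⟨-, hXodd, hXlt⟩ := Finset.mem_filter.1 hXF
  have hX1 := hz.odd_cut X hXodd
  set t := (cutWeight z X - 1) / (cutWeight z X - cutWeight s X) with ht
  have hden : 0 < cutWeight z X - cutWeight s X := by linarith
  have ht0 : 0 ≤ t := div_nonneg (by linarith) hden.le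
  have ht1 : t ≤ 1 := (div_le_one hden).2 (by linarith)
  let z' : V → V → ℝ := fun u v => (1 - t) * z u v + t * s u v
  have hcut : ∀ Y, cutWeight z' Y = (1 - t) * cutWeight z Y + t * cutWeight s Y := fun Y => by
    simp only [cutWeight, z', Finset.sum_add_distrib, Finset.mul_sum]
  have hdiag : ∀ v, z' v v = 0 := fun v => by simp [z', hz.diag, hs_diag]
  have hdeg : ∀ v, ∑ u, z' v u = 1 := fun v => by
    simp only [z', Finset.sum_add_distrib, ← Finset.mul_sum, hz.degree, hs_deg]; ring
  have hsymm : ∀ u v, z' u v = z' v u := fun u v => by simp only [z', hz.symm u v, hs_symm u v]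
  refine ⟨z', ⟨hsymm, ?_, hdiag, hdeg, ?_⟩, ?_, X, hXodd, ?_, ?_⟩
  · intro u v
    exact add_nonneg (mul_nonneg (by linarith) (hz.nonneg _ _)) (mul_nonneg ht0 (hs_nonneg _ _))
  · intro Y hY
    rw [hcut]
    have h1 := hz.odd_cut Y hY
    by_cases h2 : cutWeight s Y < 1
    · have h3 := hXmin Y (Finset.mem_filter.2 ⟨Finset.mem_univ _, hY, h2⟩)
      rw [le_div_iff₀ (by linarith)] at h3
      linarith
    · nlinarith
  · have : ∑ u, ∑ v, c u v * z' u v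
        = (1 - t) * ∑ u, ∑ v, c u v * z u v + t * ∑ u, ∑ v, c u v * s u v := by
      simp only [z', mul_add, Finset.sum_add_distrib, Finset.mul_sum, mul_left_comm]
    rw [this, hs_cost]
    nlinarith
  · rw [hcut, ht]
    field_simp
    ring
  · -- stars have weight `1` with respect to `s`, so `X` is not a star
    have hstar : ∀ v, cutWeight s {v} = 1 := fun v => by rw [cutWeight_singleton hs_diag, hs_deg]
    have hX1 : X.card ≠ 1 := fun h => by
      obtain ⟨v, rfl⟩ := Finset.card_eq_one.1 h
      linarith [hstar v]
    have hX2 : Xᶜ.card ≠ 1 := fun h => by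
      obtain ⟨v, hv⟩ := Finset.card_eq_one.1 h
      have := cutWeight_compl hs_symm X
      rw [hv] at this
      linarith [hstar v]
    have h3 := Finset.card_add_card_compl X
    obtain ⟨k, hk⟩ := hXodd
    obtain ⟨l, hl⟩ := hV
    omega

/-- The edge weights after contracting the complement of `K` to the point `none`. -/
def collapseWeight (z : V → V → ℝ) (K : Finset V) (a b : Option {v // v ∈ K}) : ℝ :=
  if a = b then 0 else
    ∑ i ∈ Finset.univ.filter (collapse K · = a), ∑ j ∈ Finset.univ.filter (collapse K · = b), z i j

theorem filter_collapse_some {K : Finset V} (k : {v // v ∈ K}) :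
    Finset.univ.filter (collapse K · = some k) = {k.1} := by
  ext v
  by_cases h : v ∈ K
  · simp [collapse, h, Subtype.ext_iff]
  · have : v ≠ k.1 := fun e => h (e ▸ k.2)
    simp [collapse, this]

theorem filter_collapse_none {K : Finset V} : Finset.univ.filter (collapse K · = none) = Kᶜ := by
  ext v
  by_cases h : v ∈ K <;> simp [collapse, h]

theorem cutWeight_collapseWeight (z : V → V → ℝ) (K : Finset V)
    (T : Finset (Option {v // v ∈ K})) :
    cutWeight (collapseWeight z K) T = cutWeight z (Finset.univ.filter (collapse K · ∈ T)) := by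
  have h1 : ∀ a ∈ T, ∀ b ∈ Tᶜ, collapseWeight z K a b
      = ∑ i ∈ Finset.univ.filter (collapse K · = a),
          ∑ j ∈ Finset.univ.filter (collapse K · = b), z i j := by
    intro a ha b hb
    have : a ≠ b := fun e => (Finset.mem_compl.1 hb) (e ▸ ha)
    rw [collapseWeight, if_neg this]
  have hfib : ∀ (U : Finset (Option {v // v ∈ K})) (f : V → ℝ),
      ∑ a ∈ U, ∑ i ∈ Finset.univ.filter (collapse K · = a), f i
        = ∑ i ∈ Finset.univ.filter (collapse K · ∈ U), f i := by
    intro U f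
    rw [← Finset.sum_fiberwise_of_maps_to (s := Finset.univ.filter (collapse K · ∈ U)) (t := U)
      (g := collapse K) (by simp)]
    refine Finset.sum_congr rfl fun a ha => Finset.sum_congr ?_ fun _ _ => rfl
    ext i
    simp only [Finset.mem_filter, Finset.mem_univ, true_and]
    exact ⟨fun h => ⟨h ▸ ha, h⟩, fun h => h.2⟩
  have hcompl : (Finset.univ.filter (collapse K · ∈ T))ᶜ
      = Finset.univ.filter (collapse K · ∈ Tᶜ) := by
    ext i; simp
  rw [cutWeight, cutWeight, hcompl, ← hfib T]
  refine Finset.sum_congr rfl fun a ha => ?_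
  rw [Finset.sum_congr rfl (h1 a ha), Finset.sum_comm]
  exact Finset.sum_congr rfl fun i _ => hfib Tᶜ _

theorem IsFractionalMatching.contract {z : V → V → ℝ} (hz : IsFractionalMatching z) {K : Finset V}
    (hK : Odd Kᶜ.card) (hcut : cutWeight z K = 1) :
    IsFractionalMatching (collapseWeight z K) := by
  have hdiag : ∀ a, collapseWeight z K a a = 0 := fun a => by simp [collapseWeight]
  have hodd : ∀ a, Odd (Finset.univ.filter (collapse K · = a)).card := by
    rintro (_ | k)
    · rwa [filter_collapse_none]
    · rw [filter_collapse_some]; simp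
  refine ⟨?_, ?_, hdiag, ?_, ?_⟩
  · intro a b
    unfold collapseWeight
    by_cases hab : a = b
    · simp [hab]
    · rw [if_neg hab, if_neg (Ne.symm hab), Finset.sum_comm]
      simp only [hz.symm]
  · intro a b
    unfold collapseWeight
    split_ifs
    · exact le_rfl
    · exact Finset.sum_nonneg fun i _ => Finset.sum_nonneg fun j _ => hz.nonneg i j
  · intro a
    rw [← cutWeight_singleton hdiag, cutWeight_collapseWeight]
    simp only [Finset.mem_singleton]
    rcases a with _ | k
    · rw [filter_collapse_none, cutWeight_compl hz.symm, hcut]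
    · rw [filter_collapse_some, cutWeight_singleton hz.diag, hz.degree]
  · intro T hT
    rw [cutWeight_collapseWeight]
    apply hz.odd_cut
    rw [Finset.card_eq_sum_card_fiberwise (f := collapse K) (t := T) (fun i hi => by
      simpa using hi), Finset.odd_sum_iff_odd_card_odd]
    rw [Finset.filter_true_of_mem]
    · exact hT
    intro a ha
    convert hodd a using 2
    ext i
    simp only [Finset.mem_filter, Finset.mem_univ, true_and]
    exact ⟨fun h => h.2, fun h => ⟨h ▸ ha, h⟩⟩

theorem sum_mul_collapseWeight (z : V → V → ℝ) (hd : ∀ v, z v v = 0) (K : Finset V)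
    (c : Option {v // v ∈ K} → Option {v // v ∈ K} → ℝ) (hc : c none none = 0) :
    ∑ a, ∑ b, c a b * collapseWeight z K a b
      = ∑ i, ∑ j, c (collapse K i) (collapse K j) * z i j := by
  have hfib : ∀ f : V → ℝ, ∑ i, f i
      = ∑ a, ∑ i ∈ Finset.univ.filter (collapse K · = a), f i := fun f =>
    (Finset.sum_fiberwise (s := Finset.univ) (g := collapse K) (f := f)).symm
  rw [hfib]
  refine Finset.sum_congr rfl fun a _ => ?_
  rw [Finset.sum_congr rfl (fun i _ => hfib _), Finset.sum_comm]
  refine Finset.sum_congr rfl fun b _ => ?_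
  have h1 : ∑ i ∈ Finset.univ.filter (collapse K · = a),
      ∑ j ∈ Finset.univ.filter (collapse K · = b), c (collapse K i) (collapse K j) * z i j
      = c a b * ∑ i ∈ Finset.univ.filter (collapse K · = a),
          ∑ j ∈ Finset.univ.filter (collapse K · = b), z i j := by
    rw [Finset.mul_sum]
    refine Finset.sum_congr rfl fun i hi => ?_
    rw [Finset.mul_sum]
    refine Finset.sum_congr rfl fun j hj => ?_
    rw [(Finset.mem_filter.1 hi).2, (Finset.mem_filter.1 hj).2]
  rw [h1, collapseWeight]
  split_ifs with hab
  · subst hab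
    rcases a with _ | k
    · simp [hc]
    · simp [filter_collapse_some, hd]
  · rfl

end

section
variable {α : Type u}

/-- Lengths on `Option α` given by lengths `f` inside `α` and lengths `g` of the edges
to `none`. -/
def optionLen (f : α → α → ℝ) (g : α → ℝ) : Option α → Option α → ℝ
  | none, none => 0
  | none, some a => g a
  | some a, o => o.elim (g a) (f a)

variable [Fintype α] [DecidableEq α]

theorem IsPerfectMatching.sum_elim {M : Option α → Option α} (hM : IsPerfectMatching M) {s : α}
    (hs : M none = some s) (f : α → α → ℝ) (g : α → ℝ) :
    ∑ a, (M (some a)).elim (g a) (f a) = ∑ a, (M (some a)).elim 0 (f a) + g s := by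
  have h : ∀ a, (M (some a)).elim (g a) (f a)
      = (M (some a)).elim 0 (f a) + if a = s then g s else 0 := by
    intro a
    by_cases ha : a = s
    · have : M (some s) = none := by rw [← hs, hM.invol]
      simp [ha, this]
    · rcases h : M (some a) with _ | t
      · have h2 := hM.invol (some a)
        rw [h, hs] at h2
        exact absurd (Option.some.inj h2).symm ha
      · simp [ha]
  simp only [h, Finset.sum_add_distrib, Finset.sum_ite_eq', Finset.mem_univ, if_true]

theorem IsPerfectMatching.sum_optionLen {M : Option α → Option α} (hM : IsPerfectMatching M) {s : α}
    (hs : M none = some s) (f : α → α → ℝ) (g : α → ℝ) :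
    ∑ a, optionLen f g a (M a) = ∑ a, (M (some a)).elim 0 (f a) + 2 * g s := by
  rw [Fintype.sum_option, hs]
  have := hM.sum_elim hs f g
  simp only [optionLen]
  rw [this]; ring

end

end

/-! ### Edmonds' perfect matching theorem -/

section

/-- The statement of Edmonds' theorem for the vertex set `V`: a fractional perfect matching is at
least as long as some perfect matching. -/
def MatchingDominated (V : Type u) [Fintype V] [DecidableEq V] : Prop :=
  ∀ z : V → V → ℝ, IsFractionalMatching z → ∀ c : V → V → ℝ, (∀ u v, c u v = c v u) →
    (∀ v, c v v = 0) →
    ∃ M : V → V, IsPerfectMatching M ∧ ∑ v, c v (M v) ≤ ∑ u, ∑ v, c u v * z u v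

variable {V : Type u} [Fintype V] [DecidableEq V]

/-- If the odd cut of `S` is tight, then Edmonds' theorem for the two graphs obtained by contracting
either side implies the theorem for `V`. In the graph with vertex set `S` plus a contracted vertex,
an edge leaving `S` from `s` is given length `-μ s`, where `μ s` is the length of a cheapest perfect
matching of `S \ {s}`. This shows that the part of `z` inside `S` pays for `μ`.
In the other graph an edge leaving `S` has its length increased by `μ s`. -/
theorem IsFractionalMatching.exists_of_tight_cut {z : V → V → ℝ} (hz : IsFractionalMatching z)
    {c : V → V → ℝ} (hc : ∀ u v, c u v = c v u) (hd : ∀ v, c v v = 0) {S : Finset V}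
    (hS : Odd S.card) (hS' : Odd Sᶜ.card) (hcut : cutWeight z S = 1)
    (h1 : MatchingDominated (Option {v // v ∈ S}))
    (h2 : MatchingDominated (Option {v // v ∈ Sᶜ})) :
    ∃ M : V → V, IsPerfectMatching M ∧ ∑ v, c v (M v) ≤ ∑ u, ∑ v, c u v * z u v := by
  classical
  -- cheapest perfect matchings of `S \ {s}`
  have hN : ∀ s : {v // v ∈ S}, ∃ N : Option {v // v ∈ S} → Option {v // v ∈ S},
      (IsPerfectMatching N ∧ N none = some s) ∧
      ∀ N', IsPerfectMatching N' → N' none = some s →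
        ∑ a : {v // v ∈ S}, (N (some a)).elim (0 : ℝ) (fun b => c a b)
          ≤ ∑ a : {v // v ∈ S}, (N' (some a)).elim (0 : ℝ) (fun b => c a b) := by
    intro s
    have hev : Even (Fintype.card (Option {v // v ∈ S})) := by
      rw [Fintype.card_option, Fintype.card_coe]
      exact hS.add_one
    obtain ⟨N₀, hN₀, hN₀s⟩ := exists_isPerfectMatching_apply hev (Option.some_ne_none s).symm
    obtain ⟨N, hN, hmin⟩ := (Finset.univ.filter
      fun N : Option {v // v ∈ S} → Option {v // v ∈ S} =>
        IsPerfectMatching N ∧ N none = some s).exists_min_image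
      (fun N => ∑ a : {v // v ∈ S}, (N (some a)).elim (0 : ℝ) (fun b => c a b))
      ⟨N₀, by simp [hN₀, hN₀s]⟩
    refine ⟨N, by simpa using hN, fun N' h3 h4 => hmin N' (by simp [h3, h4])⟩
  choose N hN hNmin using hN
  let μ : {v // v ∈ S} → ℝ := fun s =>
    (∑ a : {v // v ∈ S}, (N s (some a)).elim (0 : ℝ) (fun b => c a b)) / 2
  have hSne : Nonempty {v // v ∈ S} := by
    obtain ⟨v, hv⟩ := Finset.card_pos.1 hS.pos
    exact ⟨⟨v, hv⟩⟩
  have hS'ne : Nonempty {v // v ∈ Sᶜ} := by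
    obtain ⟨v, hv⟩ := Finset.card_pos.1 hS'.pos
    exact ⟨⟨v, hv⟩⟩
  -- the best end `g b ∈ S` of an edge at `b ∉ S`
  have hg : ∀ b : {v // v ∈ Sᶜ}, ∃ s : {v // v ∈ S}, ∀ s' : {v // v ∈ S},
      c s b + μ s ≤ c s' b + μ s' := fun b => Finite.exists_min fun s => c s.1 b.1 + μ s
  choose g hg using hg
  let m : V → ℝ := fun v => if h : v ∈ S then μ ⟨v, h⟩ else 0
  have hm : ∀ s : {v // v ∈ S}, m s = μ s := fun s => by simp [m]
  -- the two contracted instances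
  let f₁ : {v // v ∈ S} → {v // v ∈ S} → ℝ := fun a b => c a b
  let f₂ : {v // v ∈ Sᶜ} → {v // v ∈ Sᶜ} → ℝ := fun a b => c a b
  let g₁ : {v // v ∈ S} → ℝ := fun s => -μ s
  let g₂ : {v // v ∈ Sᶜ} → ℝ := fun b => c (g b) b + μ (g b)
  have hsymm : ∀ (K : Finset V) (g' : {v // v ∈ K} → ℝ) (a b : Option {v // v ∈ K}),
      optionLen (fun a b : {v // v ∈ K} => c a b) g' a b
        = optionLen (fun a b : {v // v ∈ K} => c a b) g' b a := by
    rintro K g' (_ | a) (_ | b)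
    exacts [rfl, rfl, rfl, hc a b]
  have hdiag : ∀ (K : Finset V) (g' : {v // v ∈ K} → ℝ) (a : Option {v // v ∈ K}),
      optionLen (fun a b : {v // v ∈ K} => c a b) g' a a = 0 := by
    rintro K g' (_ | a) <;> simp [optionLen, hd]
  obtain ⟨M₁, hM₁, hM₁c⟩ := h1 _ (hz.contract hS' hcut) (optionLen f₁ g₁) (hsymm S g₁) (hdiag S g₁)
  obtain ⟨M₂, hM₂, hM₂c⟩ := h2 _ (hz.contract (K := Sᶜ) (by rwa [compl_compl])
    (by rw [cutWeight_compl hz.symm, hcut])) (optionLen f₂ g₂) (hsymm _ g₂) (hdiag _ g₂)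
  rw [sum_mul_collapseWeight z hz.diag _ _ rfl] at hM₁c hM₂c
  -- splitting a symmetric double sum according to the sides of the cut
  have hsplit : ∀ F : V → V → ℝ, (∀ u v, F u v = F v u) →
      ∑ u, ∑ v, F u v = ∑ u ∈ S, ∑ v ∈ S, F u v + ∑ u ∈ Sᶜ, ∑ v ∈ Sᶜ, F u v
        + 2 * ∑ u ∈ S, ∑ v ∈ Sᶜ, F u v := by
    intro F hF
    have e1 : ∀ u, ∑ v, F u v = ∑ v ∈ S, F u v + ∑ v ∈ Sᶜ, F u v := fun u =>
      (Finset.sum_add_sum_compl S _).symm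
    rw [← Finset.sum_add_sum_compl S]
    simp only [e1, Finset.sum_add_distrib]
    have e2 : ∑ u ∈ Sᶜ, ∑ v ∈ S, F u v = ∑ u ∈ S, ∑ v ∈ Sᶜ, F u v := by
      rw [Finset.sum_comm]; simp only [hF]
    rw [e2]; ring
  obtain ⟨s₁, hs₁⟩ := Option.ne_none_iff_exists'.1 (hM₁.ne none)
  have hpay : 2 * ∑ u ∈ S, ∑ v ∈ Sᶜ, m u * z u v ≤ ∑ u ∈ S, ∑ v ∈ S, c u v * z u v := by
    rw [hM₁.sum_optionLen hs₁, hsplit _ (fun u v => by rw [hsymm S g₁, hz.symm])] at hM₁c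
    have e0 : 0 ≤ ∑ a, (M₁ (some a)).elim 0 (f₁ a) + 2 * g₁ s₁ := by
      have := hNmin s₁ M₁ hM₁ hs₁
      simp only [g₁, μ, f₁]; linarith
    have e1 : ∑ u ∈ S, ∑ v ∈ S, optionLen f₁ g₁ (collapse S u) (collapse S v) * z u v
        = ∑ u ∈ S, ∑ v ∈ S, c u v * z u v := by
      refine Finset.sum_congr rfl fun u hu => Finset.sum_congr rfl fun v hv => ?_
      rw [collapse_of_mem hu, collapse_of_mem hv]; rfl
    have e2 : ∑ u ∈ Sᶜ, ∑ v ∈ Sᶜ, optionLen f₁ g₁ (collapse S u) (collapse S v) * z u v = 0 := by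
      refine Finset.sum_eq_zero fun u hu => Finset.sum_eq_zero fun v hv => ?_
      rw [collapse_of_notMem (Finset.mem_compl.1 hu), collapse_of_notMem (Finset.mem_compl.1 hv)]
      simp [optionLen]
    have e3 : ∑ u ∈ S, ∑ v ∈ Sᶜ, optionLen f₁ g₁ (collapse S u) (collapse S v) * z u v
        = - ∑ u ∈ S, ∑ v ∈ Sᶜ, m u * z u v := by
      simp only [← Finset.sum_neg_distrib]
      refine Finset.sum_congr rfl fun u hu => Finset.sum_congr rfl fun v hv => ?_
      rw [collapse_of_mem hu, collapse_of_notMem (Finset.mem_compl.1 hv)]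
      simp [optionLen, g₁, m, hu]
    rw [e1, e2, e3] at hM₁c
    linarith
  obtain ⟨b, hb⟩ := Option.ne_none_iff_exists'.1 (hM₂.ne none)
  have hout : ∑ a, (M₂ (some a)).elim 0 (f₂ a) + 2 * g₂ b ≤ ∑ u ∈ Sᶜ, ∑ v ∈ Sᶜ, c u v * z u v
      + 2 * ∑ u ∈ S, ∑ v ∈ Sᶜ, (c u v + m u) * z u v := by
    rw [hM₂.sum_optionLen hb, hsplit _ (fun u v => by rw [hsymm Sᶜ g₂, hz.symm])] at hM₂c
    refine hM₂c.trans (le_of_eq_of_le (b := ∑ u ∈ Sᶜ, ∑ v ∈ Sᶜ, c u v * z u v +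
      2 * ∑ u ∈ S, ∑ v ∈ Sᶜ, optionLen f₂ g₂ (collapse Sᶜ u) (collapse Sᶜ v) * z u v) ?_ ?_)
    · have e1 : ∑ u ∈ S, ∑ v ∈ S, optionLen f₂ g₂ (collapse Sᶜ u) (collapse Sᶜ v) * z u v = 0 := by
        refine Finset.sum_eq_zero fun u hu => Finset.sum_eq_zero fun v hv => ?_
        rw [collapse_of_notMem (by simpa using hu), collapse_of_notMem (by simpa using hv)]
        simp [optionLen]
      have e2 : ∑ u ∈ Sᶜ, ∑ v ∈ Sᶜ, optionLen f₂ g₂ (collapse Sᶜ u) (collapse Sᶜ v) * z u v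
          = ∑ u ∈ Sᶜ, ∑ v ∈ Sᶜ, c u v * z u v := by
        refine Finset.sum_congr rfl fun u hu => Finset.sum_congr rfl fun v hv => ?_
        rw [collapse_of_mem hu, collapse_of_mem hv]; rfl
      rw [e1, e2, zero_add]
    · gcongr with u hu v hv
      · exact hz.nonneg u v
      · rw [collapse_of_notMem (by simpa using hu), collapse_of_mem hv]
        have := hg ⟨v, hv⟩ ⟨u, hu⟩
        simpa [optionLen, g₂, m, hu] using this
  -- gluing the matchings along the edge from `g b` to `b`
  have hNb := hN (g b)
  have hN1 : ∀ v (h : v ∈ S), N (g b) (some ⟨v, h⟩) = none → v = g b := by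
    intro v h hn
    have := hNb.1.invol (some ⟨v, h⟩)
    rw [hn, hNb.2] at this
    exact (congrArg Subtype.val (Option.some.inj this)).symm
  have hM2 : ∀ v (h : v ∈ Sᶜ), M₂ (some ⟨v, h⟩) = none → v = b := by
    intro v h hn
    have := hM₂.invol (some ⟨v, h⟩)
    rw [hn, hb] at this
    exact (congrArg Subtype.val (Option.some.inj this)).symm
  let M : V → V := fun v =>
    if h : v ∈ S then (N (g b) (some ⟨v, h⟩)).elim b.1 (fun t => t.1)
    else (M₂ (some ⟨v, Finset.mem_compl.2 h⟩)).elim (g b).1 (fun t => t.1)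
  have hMS : ∀ v (h : v ∈ S), M v = (N (g b) (some ⟨v, h⟩)).elim b.1 (fun t => t.1) :=
    fun v h => by simp only [M, h, dif_pos]
  have hMS' : ∀ v (h : v ∈ Sᶜ), M v = (M₂ (some ⟨v, h⟩)).elim (g b).1 (fun t => t.1) :=
    fun v h => by
      have h' := Finset.mem_compl.1 h
      simp only [M, h', dif_neg, not_false_iff]
  have hgN : N (g b) (some (g b)) = none := by rw [← hNb.2, hNb.1.invol]
  have hbM : M₂ (some b) = none := by rw [← hb, hM₂.invol]
  have hMg : M (g b) = b := by rw [hMS _ (g b).2, hgN]; rfl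
  have hMb : M b = g b := by rw [hMS' _ b.2, hbM]; rfl
  refine ⟨M, ⟨fun v => ?_, fun v hv => ?_⟩, ?_⟩
  · by_cases h : v ∈ S
    · rcases h3 : N (g b) (some ⟨v, h⟩) with _ | t
      · rw [hN1 v h h3, hMg, hMb]
      · have h4 : N (g b) (some t) = some ⟨v, h⟩ := by rw [← h3, hNb.1.invol]
        rw [hMS v h, h3, Option.elim_some, hMS _ t.2, h4, Option.elim_some]
    · have h' := Finset.mem_compl.2 h
      rcases h3 : M₂ (some ⟨v, h'⟩) with _ | t
      · rw [hM2 v h' h3, hMb, hMg]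
      · have h4 : M₂ (some t) = some ⟨v, h'⟩ := by rw [← h3, hM₂.invol]
        rw [hMS' v h', h3, Option.elim_some, hMS' _ t.2, h4, Option.elim_some]
  · by_cases h : v ∈ S
    · rcases h3 : N (g b) (some ⟨v, h⟩) with _ | t
      · rw [hMS v h, h3] at hv
        exact (Finset.mem_compl.1 b.2) (by rw [Option.elim_none] at hv; rwa [hv])
      · rw [hMS v h, h3, Option.elim_some] at hv
        exact hNb.1.ne (some ⟨v, h⟩) (by rw [h3]; exact congrArg some (Subtype.ext hv))
    · have h' := Finset.mem_compl.2 h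
      rcases h3 : M₂ (some ⟨v, h'⟩) with _ | t
      · rw [hMS' v h', h3, Option.elim_none] at hv
        exact h (hv ▸ (g b).2)
      · rw [hMS' v h', h3, Option.elim_some] at hv
        exact hM₂.ne (some ⟨v, h'⟩) (by rw [h3]; exact congrArg some (Subtype.ext hv))
  · have e1 : ∑ v ∈ S, c v (M v) = 2 * μ (g b) + c (g b) b := by
      rw [← Finset.sum_coe_sort]
      have := hNb.1.sum_elim hNb.2 f₁ (fun s => c s b)
      have e : 2 * μ (g b) = ∑ a, (N (g b) (some a)).elim 0 (f₁ a) := by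
        simp only [μ, f₁]; ring
      rw [e, ← this]
      refine Finset.sum_congr rfl fun v _ => ?_
      rw [hMS v v.2]
      rcases N (g b) (some v) with _ | t <;> rfl
    have e2 : ∑ v ∈ Sᶜ, c v (M v) = ∑ a, (M₂ (some a)).elim 0 (f₂ a) + c (g b) b := by
      rw [← Finset.sum_coe_sort]
      have := hM₂.sum_elim hb f₂ (fun s => c s (g b))
      rw [hc (g b), ← this]
      refine Finset.sum_congr rfl fun v _ => ?_
      rw [hMS' v v.2]
      rcases M₂ (some v) with _ | t <;> rfl
    rw [← Finset.sum_add_sum_compl S, e1, e2, hsplit _ (fun u v => by rw [hc, hz.symm])]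
    simp only [add_mul, Finset.sum_add_distrib, g₂] at hout
    linarith

/-- Edmonds' perfect matching polytope theorem. -/
theorem matchingDominated : ∀ (n : ℕ) (V : Type u) [Fintype V] [DecidableEq V],
    Fintype.card V = n → Even n → MatchingDominated V := by
  intro n
  induction n using Nat.strong_induction_on with
  | _ n ih =>
  intro V _ _ hn hev z hz c hc hd
  obtain ⟨σ, hσ, hcost⟩ := hz.exists_perm c
  by_cases h : ∀ v, Even (Function.minimalPeriod σ v)
  · obtain ⟨M, hM, hMc⟩ := exists_isPerfectMatching_of_even_cycles σ hσ h hc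
    exact ⟨M, hM, hMc.trans hcost⟩
  push Not at h
  obtain ⟨v₀, hv₀⟩ := h
  obtain ⟨z', hz', hz'c, X, hX, hXcut, hX3, hX3'⟩ :=
    hz.exists_tight_cut (hn ▸ hev) hc σ hσ hcost (by simpa using hv₀)
  have hcard := Finset.card_add_card_compl X
  have hX' : Odd Xᶜ.card := by
    rw [hn] at hcard
    rw [← hcard] at hev
    exact (Nat.even_add'.1 hev).1 hX
  obtain ⟨M, hM, hMc⟩ := hz'.exists_of_tight_cut hc hd hX hX' hXcut
    (ih (X.card + 1) (by omega) _ (by rw [Fintype.card_option, Fintype.card_coe]) hX.add_one)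
    (ih (Xᶜ.card + 1) (by omega) _ (by rw [Fintype.card_option, Fintype.card_coe]) hX'.add_one)
  exact ⟨M, hM, hMc.trans hz'c⟩

end

/-! ### Fractional joins and splitting off -/

section

variable {V : Type u} [DecidableEq V]

/-- The indicator weights of the edge `ab`; they vanish if `a = b`. -/
def edgeWeight (a b i j : V) : ℝ :=
  if i = j then 0 else (if i = a ∧ j = b then 1 else 0) + (if i = b ∧ j = a then 1 else 0)

theorem edgeWeight_symm (a b i j : V) : edgeWeight a b i j = edgeWeight a b j i := by
  unfold edgeWeight
  by_cases h : i = j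
  · simp [h]
  · rw [if_neg h, if_neg (Ne.symm h), add_comm]
    simp only [and_comm]

theorem edgeWeight_nonneg (a b i j : V) : 0 ≤ edgeWeight a b i j := by
  unfold edgeWeight; split_ifs <;> norm_num

variable [Fintype V]

/-- Fractional `Q`-joins: weights for which every cut with an odd number of vertices of `Q` on either
side has weight at least `1`. -/
structure IsFractionalJoin (Q : Finset V) (z : V → V → ℝ) : Prop where
  symm : ∀ u v, z u v = z v u
  nonneg : ∀ u v, 0 ≤ z u v
  diag : ∀ v, z v v = 0
  odd_cut : ∀ S : Finset V, Odd (S ∩ Q).card → 1 ≤ cutWeight z S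

/-- Lengths satisfying the triangle inequality, with length `0` between equal vertices. -/
structure IsMetric {V : Type u} (c : V → V → ℝ) : Prop where
  symm : ∀ u v, c u v = c v u
  nonneg : ∀ u v, 0 ≤ c u v
  diag : ∀ v, c v v = 0
  triangle : ∀ u v w, c u w ≤ c u v + c v w

theorem two_mul_cutWeight {z : V → V → ℝ} (hz : ∀ u v, z u v = z v u) (S : Finset V) :
    2 * cutWeight z S = ∑ i, ∑ j, (if i ∈ S ↔ j ∈ S then 0 else 1) * z i j := by
  have h1 : cutWeight z S = ∑ i, ∑ j, (if i ∈ S ∧ j ∉ S then 1 else 0) * z i j := by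
    rw [cutWeight, ← Finset.sum_filter_add_sum_filter_not Finset.univ (· ∈ S)]
    have : ∑ i ∈ Finset.univ.filter (¬ · ∈ S),
        ∑ j, (if i ∈ S ∧ j ∉ S then 1 else 0) * z i j = 0 := by
      refine Finset.sum_eq_zero fun i hi => Finset.sum_eq_zero fun j _ => ?_
      have : i ∉ S := (Finset.mem_filter.1 hi).2
      simp [this]
    rw [this, add_zero]
    refine Finset.sum_congr (by ext; simp) fun i hi => ?_
    rw [← Finset.sum_filter_add_sum_filter_not Finset.univ (· ∉ S)]
    have : ∑ j ∈ Finset.univ.filter (¬ · ∉ S),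
        (if i ∈ S ∧ j ∉ S then 1 else 0) * z i j = 0 := by
      refine Finset.sum_eq_zero fun j hj => ?_
      have : j ∈ S := by simpa using hj
      simp [this]
    rw [this, add_zero]
    refine Finset.sum_congr (by ext; simp) fun j hj => ?_
    have hi' : i ∈ S := by simpa using hi
    have hj' : j ∉ S := by simpa using hj
    simp [hi', hj']
  have h2 : cutWeight z S = ∑ i, ∑ j, (if j ∈ S ∧ i ∉ S then 1 else 0) * z i j := by
    rw [h1, Finset.sum_comm]
    simp only [hz]
  rw [two_mul]
  nth_rewrite 1 [h1]
  rw [h2, ← Finset.sum_add_distrib]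
  refine Finset.sum_congr rfl fun i _ => ?_
  rw [← Finset.sum_add_distrib]
  refine Finset.sum_congr rfl fun j _ => ?_
  by_cases hi : i ∈ S <;> by_cases hj : j ∈ S <;> simp [hi, hj]

theorem cutWeight_inter_add_union_le {z : V → V → ℝ} (hz : ∀ u v, z u v = z v u)
    (h0 : ∀ u v, 0 ≤ z u v) (X Y : Finset V) :
    cutWeight z (X ∩ Y) + cutWeight z (X ∪ Y) ≤ cutWeight z X + cutWeight z Y := by
  have : 2 * cutWeight z (X ∩ Y) + 2 * cutWeight z (X ∪ Y)
      ≤ 2 * cutWeight z X + 2 * cutWeight z Y := by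
    simp only [two_mul_cutWeight hz, ← Finset.sum_add_distrib, ← add_mul]
    refine Finset.sum_le_sum fun i _ => Finset.sum_le_sum fun j _ =>
      mul_le_mul_of_nonneg_right ?_ (h0 i j)
    by_cases h1 : i ∈ X <;> by_cases h2 : j ∈ X <;> by_cases h3 : i ∈ Y <;> by_cases h4 : j ∈ Y <;>
      simp [h1, h2, h3, h4]
  linarith

theorem cutWeight_sdiff_add_sdiff_le {z : V → V → ℝ} (hz : ∀ u v, z u v = z v u)
    (h0 : ∀ u v, 0 ≤ z u v) {X Y : Finset V} {s u : V} (hs : s ∈ X ∩ Y) (hu : u ∉ X ∪ Y) :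
    cutWeight z (X \ Y) + cutWeight z (Y \ X) + z u s ≤ cutWeight z X + cutWeight z Y := by
  have h1 : ∑ i, ∑ j, ((if i ∈ X \ Y ↔ j ∈ X \ Y then 0 else 1) * z i j
        + (if i ∈ Y \ X ↔ j ∈ Y \ X then 0 else 1) * z i j
        + if j = s then (if i = u then 2 * z i j else 0) else 0)
      ≤ ∑ i, ∑ j, ((if i ∈ X ↔ j ∈ X then 0 else 1) * z i j
        + (if i ∈ Y ↔ j ∈ Y then 0 else 1) * z i j) := by
    refine Finset.sum_le_sum fun i _ => Finset.sum_le_sum fun j _ => ?_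
    have hij := h0 i j
    by_cases hjs : j = s
    · by_cases hiu : i = u
      · subst hjs hiu
        simp only [Finset.mem_union, not_or, Finset.mem_inter] at hs hu
        simp [hs.1, hs.2, hu.1, hu.2]; linarith
      · rw [if_pos hjs, if_neg hiu, add_zero, ← add_mul, ← add_mul]
        refine mul_le_mul_of_nonneg_right ?_ hij
        by_cases h1 : i ∈ X <;> by_cases h2 : j ∈ X <;> by_cases h3 : i ∈ Y <;>
          by_cases h4 : j ∈ Y <;> simp [h1, h2, h3, h4]
    · rw [if_neg hjs, add_zero, ← add_mul, ← add_mul]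
      refine mul_le_mul_of_nonneg_right ?_ hij
      by_cases h1 : i ∈ X <;> by_cases h2 : j ∈ X <;> by_cases h3 : i ∈ Y <;>
        by_cases h4 : j ∈ Y <;> simp [h1, h2, h3, h4]
  simp only [Finset.sum_add_distrib, ← two_mul_cutWeight hz, Finset.sum_ite_eq', Finset.mem_univ,
    if_true] at h1
  linarith

theorem sum_mul_edgeWeight {c : V → V → ℝ} (hc : ∀ u v, c u v = c v u) (hd : ∀ v, c v v = 0)
    (a b : V) : ∑ i, ∑ j, c i j * edgeWeight a b i j = 2 * c a b := by
  have h : ∀ i j, c i j * edgeWeight a b i j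
      = (if i = a then (if j = b then c i j else 0) else 0)
        + (if i = b then (if j = a then c i j else 0) else 0) := by
    intro i j
    unfold edgeWeight
    by_cases hij : i = j
    · subst hij; simp [hd]
    · rw [if_neg hij, mul_add, ite_and, ite_and]
      split_ifs <;> simp
  simp only [h, Finset.sum_add_distrib]
  simp [Finset.sum_ite_irrel, hc b a, two_mul]

theorem cutWeight_edgeWeight (a b : V) (S : Finset V) :
    cutWeight (edgeWeight a b) S = if a ∈ S ↔ b ∈ S then 0 else 1 := by
  have h : ∀ i ∈ S, ∀ j ∈ Sᶜ, edgeWeight a b i j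
      = (if i = a then (if j = b then 1 else 0) else 0)
        + (if i = b then (if j = a then 1 else 0) else 0) := by
    intro i hi j hj
    have : i ≠ j := fun e => Finset.mem_compl.1 hj (e ▸ hi)
    rw [edgeWeight, if_neg this, ite_and, ite_and]
  rw [cutWeight, Finset.sum_congr rfl fun i hi => Finset.sum_congr rfl (h i hi)]
  simp only [Finset.sum_add_distrib, Finset.sum_ite_irrel, Finset.sum_ite_eq', Finset.mem_compl,
    Finset.sum_const_zero]
  by_cases h1 : a ∈ S <;> by_cases h2 : b ∈ S <;> simp [h1, h2]

/-- Splitting off `us` and `ut` at `u` by a small amount is possible unless there is a tight odd set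
containing `s` and `t` but not `u`. -/
theorem IsFractionalJoin.exists_split {Q : Finset V} (hQ : Even Q.card) {z : V → V → ℝ}
    (hz : IsFractionalJoin Q z) {u s t : V} (hs : 0 < z u s) (ht : 0 < z u t)
    (hno : ∀ X : Finset V, Odd (X ∩ Q).card → cutWeight z X = 1 → s ∈ X → t ∈ X → u ∈ X) :
    ∃ ε > 0, IsFractionalJoin Q fun i j =>
      z i j - ε * (edgeWeight u s i j + edgeWeight u t i j - edgeWeight s t i j) := by
  have hus : u ≠ s := fun e => by rw [e, hz.diag] at hs; exact lt_irrefl _ hs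
  have hut : u ≠ t := fun e => by rw [e, hz.diag] at ht; exact lt_irrefl _ ht
  -- a common slack `δ` of the odd cuts that are not tight
  have hslack : ∃ δ > 0, ∀ S : Finset V, 1 < cutWeight z S → 1 + 2 * δ ≤ cutWeight z S := by
    by_cases hF : (Finset.univ.filter fun S : Finset V => 1 < cutWeight z S).Nonempty
    · obtain ⟨S₀, hS₀, hmin⟩ := Finset.exists_min_image _ (cutWeight z) hF
      have := (Finset.mem_filter.1 hS₀).2
      refine ⟨(cutWeight z S₀ - 1) / 2, by linarith, fun S hS => ?_⟩
      have := hmin S (by simpa using hS)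
      linarith
    · refine ⟨1, one_pos, fun S hS => absurd ⟨S, ?_⟩ hF⟩
      simpa using hS
  obtain ⟨δ, hδ, hslack⟩ := hslack
  refine ⟨min δ (min (z u s / 2) (z u t / 2)), by positivity, ?_⟩
  set ε := min δ (min (z u s / 2) (z u t / 2))
  have hε : 0 < ε := by positivity
  have hε1 : ε ≤ δ := min_le_left _ _
  have hε2 : ε ≤ z u s / 2 := (min_le_right _ _).trans (min_le_left _ _)
  have hε3 : ε ≤ z u t / 2 := (min_le_right _ _).trans (min_le_right _ _)
  refine ⟨?_, ?_, ?_, ?_⟩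
  · intro i j
    rw [hz.symm i j, edgeWeight_symm u s i j, edgeWeight_symm u t i j, edgeWeight_symm s t i j]
  · have hle : ∀ v, u ≠ v → ε ≤ z u v / 2 → ∀ i j, ε * edgeWeight u v i j ≤ z i j / 2 := by
      intro v huv hv i j
      have h0 := hz.nonneg i j
      unfold edgeWeight
      by_cases h1 : i = u ∧ j = v
      · have h2 : ¬ (i = v ∧ j = u) := fun h => huv (h1.1.symm.trans h.1)
        rw [if_pos h1, if_neg h2, h1.1, h1.2]
        split_ifs <;> linarith
      · by_cases h2 : i = v ∧ j = u
        · rw [if_neg h1, if_pos h2, h2.1, h2.2, hz.symm v u]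
          split_ifs
          · rw [mul_zero]; have := hz.nonneg u v; linarith
          · linarith
        · rw [if_neg h1, if_neg h2]
          split_ifs <;> linarith
    intro i j
    have h1 := hle s hus hε2 i j
    have h2 := hle t hut hε3 i j
    have h3 := mul_nonneg hε.le (edgeWeight_nonneg s t i j)
    linarith
  · intro v
    simp [hz.diag, edgeWeight]
  · intro S hS
    have hcut : cutWeight (fun i j =>
        z i j - ε * (edgeWeight u s i j + edgeWeight u t i j - edgeWeight s t i j)) S
        = cutWeight z S - ε * (cutWeight (edgeWeight u s) S + cutWeight (edgeWeight u t) S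
          - cutWeight (edgeWeight s t) S) := by
      simp only [cutWeight, Finset.sum_sub_distrib, Finset.sum_add_distrib, ← Finset.mul_sum]
    have h1 := hz.odd_cut S hS
    -- only sets separating `u` from `s` and `t` lose weight
    have hloss : (u ∈ S ∧ s ∉ S ∧ t ∉ S) ∨ (u ∉ S ∧ s ∈ S ∧ t ∈ S) →
        1 + 2 * δ ≤ cutWeight z S := by
      intro h
      apply hslack
      refine lt_of_le_of_ne h1 fun e => ?_
      rcases h with ⟨h2, h3, h4⟩ | ⟨h2, h3, h4⟩
      · refine Finset.mem_compl.1 (hno Sᶜ ?_ ?_ (Finset.mem_compl.2 h3) (Finset.mem_compl.2 h4)) h2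
        · have h5 : (S ∩ Q).card + (Sᶜ ∩ Q).card = Q.card := by
            rw [← Finset.card_union_of_disjoint, ← Finset.union_inter_distrib_right,
              Finset.union_compl, Finset.univ_inter]
            exact Finset.disjoint_of_subset_left Finset.inter_subset_left
              (Finset.disjoint_of_subset_right Finset.inter_subset_left disjoint_compl_right)
          rw [← h5] at hQ
          exact (Nat.even_add'.1 hQ).1 hS
        · rw [cutWeight_compl hz.symm, e]
      · exact h2 (hno S hS e.symm h3 h4)
    rw [hcut, cutWeight_edgeWeight, cutWeight_edgeWeight, cutWeight_edgeWeight]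
    by_cases h2 : u ∈ S <;> by_cases h3 : s ∈ S <;> by_cases h4 : t ∈ S <;>
      simp [h2, h3, h4] at hloss ⊢ <;> linarith

/-- If no splitting off at `u` is possible, then the tight odd sets blocking the pairs of neighbours
of `u` can be uncrossed to a single one containing all neighbours. Hence the degree of `u` is
`0` or `1`. -/
theorem IsFractionalJoin.degree_of_blocked {Q : Finset V} {z : V → V → ℝ}
    (hz : IsFractionalJoin Q z) {u : V}
    (hblock : ∀ s t, 0 < z u s → 0 < z u t →
      ∃ X : Finset V, Odd (X ∩ Q).card ∧ cutWeight z X = 1 ∧ s ∈ X ∧ t ∈ X ∧ u ∉ X) :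
    (u ∉ Q → ∀ v, z u v = 0) ∧ (u ∈ Q → ∑ v, z u v = 1) := by
  by_cases hN : ∃ s, 0 < z u s
  swap
  · have h0 : ∀ v, z u v = 0 := fun v =>
      le_antisymm (not_lt.1 fun h => hN ⟨v, h⟩) (hz.nonneg u v)
    refine ⟨fun _ => h0, fun hu => ?_⟩
    have := hz.odd_cut {u} (by rw [Finset.singleton_inter_of_mem hu]; simp)
    rw [cutWeight_singleton hz.diag] at this
    simp [h0] at this
    linarith
  obtain ⟨s, hs⟩ := hN
  let F : Finset (Finset V) := Finset.univ.filter fun X =>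
    Odd (X ∩ Q).card ∧ cutWeight z X = 1 ∧ s ∈ X ∧ u ∉ X
  have hunion : ∀ X ∈ F, ∀ Y ∈ F, X ∪ Y ∈ F := by
    intro X hX Y hY
    obtain ⟨-, hX1, hX2, hX3, hX4⟩ := Finset.mem_filter.1 hX
    obtain ⟨-, hY1, hY2, hY3, hY4⟩ := Finset.mem_filter.1 hY
    have hu : u ∉ X ∪ Y := by simp [hX4, hY4]
    have hcard : ((X ∪ Y) ∩ Q).card + ((X ∩ Y) ∩ Q).card = (X ∩ Q).card + (Y ∩ Q).card := by
      rw [Finset.union_inter_distrib_right, Finset.inter_inter_distrib_right,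
        Finset.card_union_add_card_inter]
    by_cases hodd : Odd ((X ∪ Y) ∩ Q).card
    · have hodd' : Odd ((X ∩ Y) ∩ Q).card := by
        have : Even (((X ∪ Y) ∩ Q).card + ((X ∩ Y) ∩ Q).card) := by
          rw [hcard]; exact hX1.add_odd hY1
        exact (Nat.even_add'.1 this).1 hodd
      have h1 := hz.odd_cut _ hodd
      have h2 := hz.odd_cut _ hodd'
      have h3 := cutWeight_inter_add_union_le hz.symm hz.nonneg X Y
      refine Finset.mem_filter.2 ⟨Finset.mem_univ _, hodd, by linarith, ?_, hu⟩
      exact Finset.mem_union_left _ hX3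
    · exfalso
      have hsd : ∀ A B : Finset V, ((A \ B) ∩ Q).card + ((A ∩ B) ∩ Q).card = (A ∩ Q).card := by
        intro A B
        rw [← Finset.card_union_of_disjoint, ← Finset.union_inter_distrib_right,
          Finset.sdiff_union_inter]
        exact Finset.disjoint_of_subset_left Finset.inter_subset_left
          (Finset.disjoint_of_subset_right Finset.inter_subset_left
            (Finset.disjoint_sdiff_inter A B))
      have e1 := hsd X Y
      have e2 := hsd Y X
      rw [Finset.inter_comm Y X] at e2
      rw [Nat.odd_iff] at hodd hX1 hY1
      have h1 := hz.odd_cut (X \ Y) (by rw [Nat.odd_iff]; omega)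
      have h2 := hz.odd_cut (Y \ X) (by rw [Nat.odd_iff]; omega)
      have h3 := cutWeight_sdiff_add_sdiff_le hz.symm hz.nonneg
        (Finset.mem_inter.2 ⟨hX3, hY3⟩) hu
      linarith
  obtain ⟨X₀, a1, a2, a3, -, a4⟩ := hblock s s hs hs
  obtain ⟨X, hXF, hXmax⟩ := F.exists_max_image Finset.card
    ⟨X₀, Finset.mem_filter.2 ⟨Finset.mem_univ _, a1, a2, a3, a4⟩⟩
  have hXN : ∀ t, t ∉ X → z u t = 0 := by
    intro t htX
    by_contra hne
    obtain ⟨Y, b1, b2, b3, b4, b5⟩ := hblock s t hs (lt_of_le_of_ne (hz.nonneg u t) (Ne.symm hne))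
    have hY : Y ∈ F := Finset.mem_filter.2 ⟨Finset.mem_univ _, b1, b2, b3, b5⟩
    have h1 := hXmax _ (hunion X hXF Y hY)
    have h2 := Finset.eq_of_subset_of_card_le Finset.subset_union_left h1
    exact htX (h2 ▸ Finset.mem_union_right _ b4)
  obtain ⟨-, hX1, hX2, hX3, hX4⟩ := Finset.mem_filter.1 hXF
  have hdeg : ∑ v, z u v = ∑ i ∈ X, z i u := by
    rw [← Finset.sum_add_sum_compl X, Finset.sum_eq_zero (s := Xᶜ)
      fun t ht => hXN t (Finset.mem_compl.1 ht), add_zero]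
    exact Finset.sum_congr rfl fun i _ => hz.symm u i
  have hcompl : Xᶜ = insert u (insert u X)ᶜ := by
    ext i
    by_cases h : i = u <;> simp [h, hX4]
  have hcutX : cutWeight z X = ∑ i ∈ X, z i u + cutWeight z (insert u X) := by
    have h1 : ∑ j ∈ (insert u X)ᶜ, z u j = 0 := Finset.sum_eq_zero fun j hj => hXN j (by
      simp at hj; exact hj.2)
    rw [cutWeight, cutWeight, Finset.sum_insert hX4, h1, zero_add, ← Finset.sum_add_distrib]
    refine Finset.sum_congr rfl fun i _ => ?_
    rw [hcompl, Finset.sum_insert (by simp)]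
  have hpos : 0 < ∑ i ∈ X, z i u :=
    Finset.sum_pos' (fun i _ => hz.nonneg i u) ⟨s, hX3, by rwa [hz.symm]⟩
  constructor
  · intro hu
    have h1 := hz.odd_cut (insert u X) (by rwa [Finset.insert_inter_of_notMem hu])
    linarith
  · intro hu
    have h1 := hz.odd_cut {u} (by rw [Finset.singleton_inter_of_mem hu]; simp)
    rw [cutWeight_singleton hz.diag] at h1
    have h2 : 0 ≤ cutWeight z (insert u X) :=
      Finset.sum_nonneg fun _ _ => Finset.sum_nonneg fun _ _ => hz.nonneg _ _
    linarith

/-- Among the fractional joins that are no longer than `z` there is one that is supported on `Q`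
with all degrees `1`: one of minimum total weight, as splitting off decreases the total weight. -/
theorem IsFractionalJoin.exists_degree_one {Q : Finset V} (hQ : Even Q.card) {z : V → V → ℝ}
    (hz : IsFractionalJoin Q z) {c : V → V → ℝ} (hc : IsMetric c) :
    ∃ z' : V → V → ℝ, IsFractionalJoin Q z' ∧
      ∑ i, ∑ j, c i j * z' i j ≤ ∑ i, ∑ j, c i j * z i j ∧
      ∀ u, (u ∉ Q → ∀ v, z' u v = 0) ∧ (u ∈ Q → ∑ v, z' u v = 1) := by
  set B := ∑ i, ∑ j, z i j with hB
  let K : Set (V → V → ℝ) := {z' | IsFractionalJoin Q z' ∧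
    ∑ i, ∑ j, c i j * z' i j ≤ ∑ i, ∑ j, c i j * z i j ∧ ∑ i, ∑ j, z' i j ≤ B}
  have hzK : z ∈ K := ⟨hz, le_rfl, le_rfl⟩
  have hKc : IsCompact K := by
    refine (isCompact_Icc (a := fun _ _ => (0 : ℝ)) (b := fun _ _ => B)).of_isClosed_subset ?_ ?_
    · have e : K = {z' : V → V → ℝ | (∀ u v, z' u v = z' v u) ∧ (∀ u v, 0 ≤ z' u v) ∧
          (∀ v, z' v v = 0) ∧ (∀ S : Finset V, Odd (S ∩ Q).card →
            1 ≤ ∑ u ∈ S, ∑ v ∈ Sᶜ, z' u v) ∧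
          ∑ i, ∑ j, c i j * z' i j ≤ ∑ i, ∑ j, c i j * z i j ∧ ∑ i, ∑ j, z' i j ≤ B} := by
        ext z'
        exact ⟨fun h => ⟨h.1.1, h.1.2, h.1.3, h.1.4, h.2.1, h.2.2⟩,
          fun h => ⟨⟨h.1, h.2.1, h.2.2.1, h.2.2.2.1⟩, h.2.2.2.2.1, h.2.2.2.2.2⟩⟩
      rw [e]
      simp only [Set.ofPred_and, Set.ofPred_forall]
      refine IsClosed.inter ?_ (IsClosed.inter ?_ (IsClosed.inter ?_ (IsClosed.inter ?_
        (IsClosed.inter ?_ ?_))))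
      · exact isClosed_iInter fun u => isClosed_iInter fun v =>
          isClosed_eq (by fun_prop) (by fun_prop)
      · exact isClosed_iInter fun u => isClosed_iInter fun v =>
          isClosed_le (by fun_prop) (by fun_prop)
      · exact isClosed_iInter fun u => isClosed_eq (by fun_prop) (by fun_prop)
      · exact isClosed_iInter fun S => isClosed_iInter fun _ =>
          isClosed_le (by fun_prop) (by fun_prop)
      · exact isClosed_le (by fun_prop) (by fun_prop)
      · exact isClosed_le (by fun_prop) (by fun_prop)
    · rintro z' ⟨h1, -, h3⟩
      refine ⟨h1.nonneg, fun i j => ?_⟩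
      refine le_trans ?_ (le_trans (Finset.single_le_sum (f := fun i => ∑ j, z' i j)
        (fun i _ => Finset.sum_nonneg fun j _ => h1.nonneg i j) (Finset.mem_univ i)) h3)
      exact Finset.single_le_sum (f := fun j => z' i j) (fun j _ => h1.nonneg i j)
        (Finset.mem_univ j)
  obtain ⟨z', hz'K, hmin⟩ := hKc.exists_isMinOn ⟨z, hzK⟩
    (f := fun z' => ∑ i, ∑ j, z' i j) (by fun_prop)
  obtain ⟨hz', hz'c, hz'B⟩ := hz'K
  refine ⟨z', hz', hz'c, fun u => hz'.degree_of_blocked fun s t hs ht => ?_⟩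
  by_contra hno
  push Not at hno
  obtain ⟨ε, hε, hsplit⟩ := hz'.exists_split hQ hs ht hno
  have hus : u ≠ s := fun e => by rw [e, hz'.diag] at hs; exact lt_irrefl _ hs
  have hut : u ≠ t := fun e => by rw [e, hz'.diag] at ht; exact lt_irrefl _ ht
  have hlin : ∀ f : V → V → ℝ, (∀ u v, f u v = f v u) → (∀ v, f v v = 0) →
      ∑ i, ∑ j, f i j *
        (z' i j - ε * (edgeWeight u s i j + edgeWeight u t i j - edgeWeight s t i j))
      = ∑ i, ∑ j, f i j * z' i j - 2 * ε * (f u s + f u t - f s t) := by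
    intro f hf hd
    have e : ∀ i j, f i j *
        (z' i j - ε * (edgeWeight u s i j + edgeWeight u t i j - edgeWeight s t i j))
        = f i j * z' i j - (ε * (f i j * edgeWeight u s i j) + ε * (f i j * edgeWeight u t i j)
          - ε * (f i j * edgeWeight s t i j)) := fun i j => by ring
    simp only [e, Finset.sum_sub_distrib, Finset.sum_add_distrib, ← Finset.mul_sum,
      sum_mul_edgeWeight hf hd]
    ring
  -- the total weight is the length for the lengths that are `1` on all edges
  have htot : ∀ w : V → V → ℝ, (∀ v, w v v = 0) →
      ∑ i, ∑ j, w i j = ∑ i, ∑ j, (if i = j then 0 else 1) * w i j := by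
    intro w hw
    refine Finset.sum_congr rfl fun i _ => Finset.sum_congr rfl fun j _ => ?_
    by_cases h : i = j
    · simp [h, hw]
    · simp [h]
  have hless : ∑ i, ∑ j,
      (z' i j - ε * (edgeWeight u s i j + edgeWeight u t i j - edgeWeight s t i j))
      < ∑ i, ∑ j, z' i j := by
    rw [htot _ hsplit.diag, htot _ hz'.diag, hlin _ (fun u v => by simp [eq_comm]) (by simp)]
    rw [if_neg hus, if_neg hut]
    split_ifs <;> linarith
  have hmem : (fun i j =>
      z' i j - ε * (edgeWeight u s i j + edgeWeight u t i j - edgeWeight s t i j)) ∈ K := by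
    refine ⟨hsplit, ?_, hless.le.trans hz'B⟩
    rw [hlin c hc.symm hc.diag]
    have := hc.triangle s u t
    rw [hc.symm s u] at this
    nlinarith
  exact absurd (hmin hmem) (not_le.2 hless)

/-- The `Q`-join theorem for metric lengths: a fractional `Q`-join is at least as long as some perfect
matching of `Q`. -/
theorem IsFractionalJoin.exists_matching {Q : Finset V} (hQ : Even Q.card) {z : V → V → ℝ}
    (hz : IsFractionalJoin Q z) {c : V → V → ℝ} (hc : IsMetric c) :
    ∃ M : {v // v ∈ Q} → {v // v ∈ Q}, IsPerfectMatching M ∧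
      ∑ v : {v // v ∈ Q}, c v (M v) ≤ ∑ i, ∑ j, c i j * z i j := by
  obtain ⟨z', hz', hz'c, hdeg⟩ := hz.exists_degree_one hQ hc
  have hoff : ∀ u v, u ∉ Q → z' v u = 0 := fun u v hu => by rw [hz'.symm, (hdeg u).1 hu]
  have hrestrict : ∀ f : V → ℝ, (∀ u ∉ Q, f u = 0) → ∑ b : {v // v ∈ Q}, f b = ∑ v, f v := by
    intro f hf
    rw [Finset.sum_coe_sort Q f, ← Finset.sum_add_sum_compl Q f, Finset.sum_eq_zero (s := Qᶜ)
      fun u hu => hf u (Finset.mem_compl.1 hu), add_zero]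
  have hfm : IsFractionalMatching fun a b : {v // v ∈ Q} => z' a b := by
    refine ⟨fun a b => hz'.symm a b, fun a b => hz'.nonneg a b, fun a => hz'.diag a, fun a => ?_,
      fun S hS => ?_⟩
    · rw [hrestrict (fun b => z' a b) fun u hu => hoff u a hu]
      exact (hdeg a).2 a.2
    · have hsub : S.map (Function.Embedding.subtype _) ⊆ Q := fun v hv => by
        obtain ⟨w, -, rfl⟩ := Finset.mem_map.1 hv
        exact w.2
      have h1 := hz'.odd_cut (S.map (Function.Embedding.subtype _))
        (by rwa [Finset.inter_eq_left.2 hsub, Finset.card_map])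
      refine h1.trans (le_of_eq ?_)
      rw [cutWeight, cutWeight, Finset.sum_map]
      refine Finset.sum_congr rfl fun a _ => ?_
      symm
      refine (Finset.sum_map Sᶜ (Function.Embedding.subtype _) (fun v => z' a v)).symm.trans ?_
      refine Finset.sum_subset (fun v hv => ?_) fun v hv hv' => ?_
      · simp only [Finset.mem_map, Finset.mem_compl, Function.Embedding.subtype_apply] at hv ⊢
        rintro ⟨w, hw, rfl⟩
        obtain ⟨w', hw', e⟩ := hv
        exact hw' (Subtype.ext e ▸ hw)
      · apply hoff
        intro hvQ
        simp only [Finset.mem_map, Finset.mem_compl, Function.Embedding.subtype_apply] at hv hv'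
        exact hv' ⟨⟨v, hvQ⟩, fun h => hv ⟨_, h, rfl⟩, rfl⟩
  obtain ⟨M, hM, hMc⟩ := matchingDominated _ {v // v ∈ Q} rfl (by rwa [Fintype.card_coe]) _ hfm
    (fun a b => c a b) (fun a b => hc.symm a b) (fun a => hc.diag a)
  refine ⟨M, hM, hMc.trans (le_of_eq_of_le ?_ hz'c)⟩
  rw [← hrestrict (fun i => ∑ j, c i j * z' i j)
    fun u hu => Finset.sum_eq_zero fun j _ => by rw [(hdeg u).1 hu, mul_zero]]
  refine Finset.sum_congr rfl fun a _ => ?_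
  exact hrestrict (fun j => c a j * z' a j) fun u hu => by rw [hoff u a hu, mul_zero]

end

/-! ### Euler walks and tours -/

section

section
variable {V : Type u}

/-- The length of the walk that starts at `a` and then visits the vertices of a list. -/
def pathLen (c : V → V → ℝ) : V → List V → ℝ
  | _, [] => 0
  | a, b :: l => c a b + pathLen c b l

theorem pathLen_append (c : V → V → ℝ) (a : V) (l m : List V) :
    pathLen c a (l ++ m) = pathLen c a l + pathLen c (l.getLastD a) m := by
  induction l generalizing a with
  | nil => simp [pathLen]
  | cons b l ih => simp only [List.cons_append, pathLen, ih, List.getLastD_cons]; ring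

theorem pathLen_le_of_sublist {c : V → V → ℝ} (hc : IsMetric c) (b : V) {l m : List V}
    (h : l.Sublist m) (a : V) : pathLen c a (l ++ [b]) ≤ pathLen c a (m ++ [b]) := by
  induction h generalizing a with
  | slnil => exact le_rfl
  | @cons l m x _ ih =>
    have h1 : pathLen c a (l ++ [b]) ≤ c a x + pathLen c x (l ++ [b]) := by
      cases l with
      | nil =>
        have := hc.triangle a x b
        simp only [List.nil_append, pathLen]; linarith
      | cons y l =>
        have := hc.triangle a x y
        simp only [List.cons_append, pathLen]; linarith
    have h2 := ih x
    simp only [List.cons_append, pathLen]; linarith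
  | cons_cons x _ ih =>
    have := ih x
    simp only [List.cons_append, pathLen]; linarith

variable [DecidableEq V]

/-- The degree of a vertex in a multigraph, given as a multiset of edges with (arbitrary)
orientations. -/
def multiDegree (E : Multiset (V × V)) (v : V) : ℕ :=
  (E.map Prod.fst).count v + (E.map Prod.snd).count v

/-- Adjacency in a multigraph. -/
def MultiAdj (E : Multiset (V × V)) (u v : V) : Prop := (u, v) ∈ E ∨ (v, u) ∈ E

theorem multiDegree_cons (e : V × V) (E : Multiset (V × V)) (v : V) :
    multiDegree (e ::ₘ E) v
      = multiDegree E v + ((if v = e.1 then 1 else 0) + if v = e.2 then 1 else 0) := by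
  simp only [multiDegree, Multiset.map_cons, Multiset.count_cons]
  omega

theorem multiDegree_filter {E : Multiset (V × V)} {K : V → Prop} [DecidablePred K]
    (hK : ∀ e ∈ E, K e.1 ↔ K e.2) (v : V) :
    multiDegree (E.filter fun e => K e.1) v = if K v then multiDegree E v else 0 := by
  have h1 : (E.filter fun e => K e.1).map Prod.fst = (E.map Prod.fst).filter K := by
    rw [Multiset.filter_map]; rfl
  have h2 : (E.filter fun e => K e.1).map Prod.snd = (E.map Prod.snd).filter K := by
    rw [Multiset.filter_map, Multiset.filter_congr hK]; rfl
  rw [multiDegree, h1, h2, Multiset.count_filter, Multiset.count_filter, multiDegree]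
  split_ifs <;> rfl

variable [Fintype V]

theorem sum_multiDegree (E : Multiset (V × V)) : ∑ v, multiDegree E v = 2 * E.card := by
  simp only [multiDegree, Finset.sum_add_distrib]
  rw [Multiset.sum_count_eq_card (fun _ _ => Finset.mem_univ _),
    Multiset.sum_count_eq_card (fun _ _ => Finset.mem_univ _), Multiset.card_map, Multiset.card_map]
  ring

/-- Euler's theorem, in the form of Fleury's algorithm: a multigraph in which exactly the ends of
the walk to be found have odd degree (none, if the ends agree) has a walk that uses every edge at
most once and visits the component of its start. If the first edge is a bridge, the component
left behind is toured first. -/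
theorem exists_euler_walk {c : V → V → ℝ} (hc : IsMetric c) :
    ∀ (n : ℕ) (E : Multiset (V × V)) (a b : V), E.card = n →
      (∀ v, Odd (multiDegree E v) ↔ ¬ (v = a ↔ v = b)) →
      ∃ l : List V, l.getLastD a = b ∧ pathLen c a l ≤ (E.map fun e => c e.1 e.2).sum ∧
        ∀ v, Relation.ReflTransGen (MultiAdj E) a v → v ∈ a :: l := by
  classical
  intro n
  induction n using Nat.strong_induction_on with
  | _ n ih =>
  intro E a b hn hodd
  have hsum0 : ∀ E : Multiset (V × V), 0 ≤ (E.map fun e => c e.1 e.2).sum := fun E =>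
    Multiset.sum_nonneg fun x hx => by
      obtain ⟨e, -, rfl⟩ := Multiset.mem_map.1 hx
      exact hc.nonneg _ _
  by_cases hedge : ∃ a', MultiAdj E a a'
  swap
  · have hdeg : multiDegree E a = 0 := by
      rw [multiDegree, Nat.add_eq_zero_iff, Multiset.count_eq_zero, Multiset.count_eq_zero]
      constructor
      · intro h
        obtain ⟨e, he, rfl⟩ := Multiset.mem_map.1 h
        exact hedge ⟨e.2, Or.inl he⟩
      · intro h
        obtain ⟨e, he, rfl⟩ := Multiset.mem_map.1 h
        exact hedge ⟨e.1, Or.inr he⟩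
    have hab : a = b := by
      by_contra hab
      have := (hodd a).2 (by simp [hab])
      rw [hdeg] at this
      simp at this
    refine ⟨[], hab, hsum0 E, fun v hv => ?_⟩
    rcases Relation.ReflTransGen.cases_head hv with h | ⟨w, hw, -⟩
    · simp [h]
    · exact absurd ⟨w, hw⟩ hedge
  obtain ⟨a', ha'⟩ := hedge
  -- remove one edge `e` between `a` and `a'`
  obtain ⟨e, E', rfl, he⟩ : ∃ e E', E = e ::ₘ E' ∧ (e = (a, a') ∨ e = (a', a)) := by
    rcases ha' with h | h
    · obtain ⟨E', rfl⟩ := Multiset.exists_cons_of_mem h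
      exact ⟨_, E', rfl, Or.inl rfl⟩
    · obtain ⟨E', rfl⟩ := Multiset.exists_cons_of_mem h
      exact ⟨_, E', rfl, Or.inr rfl⟩
  have hcard : E'.card < n := by rw [← hn, Multiset.card_cons]; exact Nat.lt_succ_self _
  have hce : c e.1 e.2 = c a a' := by
    rcases he with rfl | rfl
    · rfl
    · exact hc.symm _ _
  have hstep : ∀ w v, MultiAdj (e ::ₘ E') w v → MultiAdj E' w v ∨ v = a ∨ v = a' := by
    intro w v hwv
    rcases hwv with h | h <;> rcases Multiset.mem_cons.1 h with h | h
    · rcases he with rfl | rfl <;> simp only [Prod.mk.injEq] at h <;> simp [h]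
    · exact Or.inl (Or.inl h)
    · rcases he with rfl | rfl <;> simp only [Prod.mk.injEq] at h <;> simp [h]
    · exact Or.inl (Or.inr h)
  have hodd' : ∀ v, Odd (multiDegree E' v) ↔ ¬ (v = a' ↔ v = b) := by
    intro v
    have h1 : multiDegree (e ::ₘ E') v
        = multiDegree E' v + ((if v = a then 1 else 0) + if v = a' then 1 else 0) := by
      rw [multiDegree_cons]
      rcases he with rfl | rfl
      · rfl
      · simp only; omega
    have h2 := hodd v
    rw [h1, Nat.odd_iff] at h2
    rw [Nat.odd_iff]
    by_cases h3 : v = a <;> by_cases h4 : v = a' <;> by_cases h5 : v = b <;>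
      simp only [h3, h4, h5, if_true, if_false, iff_true, iff_false, true_iff, not_true] at h2 ⊢ <;>
      first | omega | (simp_all; try omega)
  have hsymm : ∀ u v, MultiAdj E' u v → MultiAdj E' v u := fun u v h => h.symm
  by_cases hK : Relation.ReflTransGen (MultiAdj E') a a'
  · obtain ⟨l, hl1, hl2, hl3⟩ := ih _ hcard E' a' b rfl hodd'
    refine ⟨a' :: l, ?_, ?_, ?_⟩
    · rw [List.getLastD_cons, hl1]
    · rw [Multiset.map_cons, Multiset.sum_cons, hce]
      simp only [pathLen]; linarith
    · have : Std.Symm (MultiAdj E') := ⟨hsymm⟩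
      have hback : Relation.ReflTransGen (MultiAdj E') a' a :=
        Relation.ReflTransGen.stdSymm.symm _ _ hK
      intro v hv
      refine List.mem_cons_of_mem _ (hl3 v ?_)
      induction hv with
      | refl => exact hback
      | tail _ h2 ih2 =>
        rcases hstep _ _ h2 with h | rfl | rfl
        · exact ih2.tail h
        · exact hback
        · exact Relation.ReflTransGen.refl
  · let K : V → Prop := fun v => Relation.ReflTransGen (MultiAdj E') a v
    have hKE : ∀ e ∈ E', K e.1 ↔ K e.2 := fun e he =>
      ⟨fun h => h.tail (Or.inl he), fun h => h.tail (Or.inr he)⟩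
    have hKE' : ∀ e ∈ E', ¬ K e.1 ↔ ¬ K e.2 := fun e he => not_congr (hKE e he)
    have hdegK := multiDegree_filter hKE
    have hdegR := multiDegree_filter (K := fun v => ¬ K v) hKE'
    have hbK : ¬ K b := by
      intro hb
      have h1 : ∀ v, Odd (multiDegree (E'.filter fun e => K e.1) v) ↔ v = b := by
        intro v
        rw [hdegK]
        split_ifs with hv
        · rw [hodd']
          have : v ≠ a' := fun e => hK (e ▸ hv)
          simp [this]
        · simp only [Nat.not_odd_zero, false_iff]
          exact fun e => hv (e ▸ hb)
      have h2 : Odd (∑ v, multiDegree (E'.filter fun e => K e.1) v) := by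
        rw [Finset.odd_sum_iff_odd_card_odd]
        have : (Finset.univ.filter fun v => Odd (multiDegree (E'.filter fun e => K e.1) v))
            = {b} := by
          ext v; simp [h1]
        rw [this]; simp
      rw [sum_multiDegree] at h2
      exact Nat.not_odd_iff_even.2 (even_two_mul _) h2
    obtain ⟨l₁, h11, h12, h13⟩ := ih _ ((Multiset.card_le_card
      (Multiset.filter_le (fun e => K e.1) E')).trans_lt hcard) _ a a rfl (fun v => by
        rw [hdegK]
        split_ifs with hv
        · have h1 : v ≠ a' := fun e => hK (e ▸ hv)
          have h2 : v ≠ b := fun e => hbK (e ▸ hv)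
          rw [hodd']; simp [h1, h2]
        · simp)
    obtain ⟨l₂, h21, h22, h23⟩ := ih _ ((Multiset.card_le_card
      (Multiset.filter_le (fun e => ¬ K e.1) E')).trans_lt hcard) _ a' b rfl (fun v => by
        rw [hdegR]
        by_cases hv : K v
        · have h1 : v ≠ a' := fun e => hK (e ▸ hv)
          have h2 : v ≠ b := fun e => hbK (e ▸ hv)
          rw [if_neg (not_not.2 hv)]
          simp [h1, h2]
        · rw [if_pos hv]
          exact hodd' v)
    refine ⟨l₁ ++ a' :: l₂, ?_, ?_, ?_⟩
    · rw [← h21]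
      simp [List.getLastD_eq_getLast?, List.getLast?_append, List.getLast?_cons]
    · rw [pathLen_append, h11, Multiset.map_cons, Multiset.sum_cons, hce]
      have h1 := congrArg (fun m => (m.map fun e => c e.1 e.2).sum)
        (Multiset.filter_add_not (fun e => K e.1) E')
      simp only [Multiset.map_add, Multiset.sum_add] at h1
      simp only [pathLen]; linarith
    · -- both parts are covered
      have hcovK : ∀ v, K v → v ∈ a :: l₁ := by
        intro v hv
        apply h13
        have : ∀ w, K w → Relation.ReflTransGen (MultiAdj (E'.filter fun e => K e.1)) a w := by
          intro w hw
          induction hw with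
          | refl => exact Relation.ReflTransGen.refl
          | tail h1 h2 ih2 =>
            refine ih2.tail ?_
            rcases h2 with h | h
            · exact Or.inl (Multiset.mem_filter.2 ⟨h, h1⟩)
            · exact Or.inr (Multiset.mem_filter.2 ⟨h, h1.tail (Or.inr h)⟩)
        exact this v hv
      have hRK : ∀ v, Relation.ReflTransGen (MultiAdj (E'.filter fun e => ¬ K e.1)) a' v →
          ¬ K v := by
        intro v hv
        rcases Relation.ReflTransGen.cases_tail hv with h | ⟨w, -, h | h⟩
        · rw [h]; exact hK
        · obtain ⟨h1, h2⟩ := Multiset.mem_filter.1 h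
          exact (hKE' _ h1).1 h2
        · exact (Multiset.mem_filter.1 h).2
      have hcov : ∀ v, Relation.ReflTransGen (MultiAdj (e ::ₘ E')) a v →
          K v ∨ Relation.ReflTransGen (MultiAdj (E'.filter fun e => ¬ K e.1)) a' v := by
        intro v hv
        induction hv with
        | refl => exact Or.inl Relation.ReflTransGen.refl
        | tail _ h2 ih2 =>
          rcases hstep _ _ h2 with h | rfl | rfl
          · rcases ih2 with h3 | h3
            · exact Or.inl (h3.tail h)
            · right
              have h4 := hRK _ h3
              refine h3.tail ?_
              rcases h with h | h
              · exact Or.inl (Multiset.mem_filter.2 ⟨h, h4⟩)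
              · exact Or.inr (Multiset.mem_filter.2 ⟨h, (hKE' _ h).2 h4⟩)
          · exact Or.inl Relation.ReflTransGen.refl
          · exact Or.inr Relation.ReflTransGen.refl
      intro v hv
      rcases hcov v hv with h | h
      · have := hcovK v h
        simp only [List.mem_cons, List.mem_append] at this ⊢
        tauto
      · have := h23 v h
        simp only [List.mem_cons, List.mem_append] at this ⊢
        tauto

/-- A connected multigraph with even degrees is at least as long as a tour through its vertices:
shortcut an Euler tour. -/
theorem exists_nodup_tour {c : V → V → ℝ} (hc : IsMetric c) (E : Multiset (V × V)) (r : V)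
    (heven : ∀ v, Even (multiDegree E v)) :
    ∃ l : List V, (r :: l).Nodup ∧ pathLen c r (l ++ [r]) ≤ (E.map fun e => c e.1 e.2).sum ∧
      ∀ v, Relation.ReflTransGen (MultiAdj E) r v → v ∈ r :: l := by
  obtain ⟨l, h1, h2, h3⟩ := exists_euler_walk hc _ E r r rfl (fun v => by
    simp [Nat.not_odd_iff_even.2 (heven v)])
  refine ⟨(l.filter (· ≠ r)).dedup, ?_, ?_, ?_⟩
  · rw [List.nodup_cons]
    exact ⟨by simp, List.nodup_dedup _⟩
  · refine (pathLen_le_of_sublist hc r ((List.dedup_sublist _).trans List.filter_sublist) r).trans ?_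
    rw [pathLen_append, h1]
    simpa [pathLen, hc.diag] using h2
  · intro v hv
    have := h3 v hv
    simp only [List.mem_cons, List.mem_dedup, List.mem_filter] at this ⊢
    by_cases h : v = r
    · exact Or.inl h
    · simpa [h] using this

end

section
variable {V : Type u} [DecidableEq V]

/-- The edge lengths of an instance as a function of two vertices, which vanishes on the
diagonal. -/
def Instance.dist (I : Instance V) (u v : V) : ℝ := if u = v then 0 else I.length s(u, v)

theorem Instance.isMetric_dist (I : Instance V) : IsMetric I.dist := by
  refine ⟨?_, ?_, ?_, ?_⟩
  · intro u v
    by_cases h : u = v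
    · rw [h]
    · simp [dist, h, Ne.symm h, Sym2.eq_swap]
  · intro u v
    unfold dist
    split_ifs with h
    · exact le_rfl
    · exact I.length_nonneg u v h
  · intro v
    simp [dist]
  · intro u v w
    unfold dist
    by_cases h1 : u = v
    · simp [h1]
    by_cases h2 : v = w
    · simp [h2]
    by_cases h3 : u = w
    · rw [if_pos h3, if_neg h1, if_neg h2]
      exact add_nonneg (I.length_nonneg u v h1) (I.length_nonneg v w h2)
    · rw [if_neg h1, if_neg h2, if_neg h3]
      exact I.length_triangle u v w h1 h2 h3

theorem exists_walk_of_nodup (I : Instance V) (b : V) : ∀ (l : List V) (a : V),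
    (a :: (l ++ [b])).Nodup → ∃ p : (⊤ : SimpleGraph V).Walk a b,
      p.support = a :: (l ++ [b]) ∧ (p.edges.map I.length).sum = pathLen I.dist a (l ++ [b]) := by
  intro l
  induction l with
  | nil =>
    intro a h
    have hab : a ≠ b := by simpa using h
    refine ⟨SimpleGraph.Walk.cons (by simpa using hab) SimpleGraph.Walk.nil, by simp, ?_⟩
    simp [pathLen, Instance.dist, hab]
  | cons x l ih =>
    intro a h
    rw [List.cons_append, List.nodup_cons] at h
    obtain ⟨p, hp1, hp2⟩ := ih x h.2
    have hax : a ≠ x := fun e => h.1 (by simp [e])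
    refine ⟨SimpleGraph.Walk.cons (by simpa using hax) p, by simp [hp1], ?_⟩
    simp [pathLen, Instance.dist, hax, hp2]

/-- A list of distinct vertices starting with the root defines a tour. -/
theorem Instance.exists_tour_of_nodup (I : Instance V) (l : List V) (hl : (I.root :: l).Nodup) :
    ∃ C : (⊤ : SimpleGraph V).Walk I.root I.root, IsTour C ∧
      (∀ v, v ∈ C.support ↔ v ∈ I.root :: l) ∧
      (C.edges.map I.length).sum = pathLen I.dist I.root (l ++ [I.root]) := by
  match l, hl with
  | [], _ => exact ⟨SimpleGraph.Walk.nil, Or.inl rfl, by simp, by simp [pathLen, dist]⟩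
  | [v], hl =>
    have hv : I.root ≠ v := by simpa using hl
    refine ⟨SimpleGraph.Walk.cons (by simpa using hv)
      (SimpleGraph.Walk.cons (by simpa using hv.symm) SimpleGraph.Walk.nil),
      Or.inr (Or.inl rfl), ?_, ?_⟩
    · intro w; simp; tauto
    · simp [pathLen, dist, hv, hv.symm]
  | v :: w :: l, hl =>
    have hr : I.root ∉ v :: w :: l := (List.nodup_cons.1 hl).1
    have hn := (List.nodup_cons.1 hl).2
    have hnodup : (v :: ((w :: l) ++ [I.root])).Nodup := by
      rw [← List.cons_append, List.nodup_append]
      refine ⟨hn, by simp, ?_⟩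
      intro a ha b hb hab
      rw [List.mem_singleton] at hb
      exact hr (hb ▸ hab ▸ ha)
    obtain ⟨hv, hn'⟩ := List.nodup_cons.1 hnodup
    obtain ⟨p, hp1, hp2⟩ := exists_walk_of_nodup I I.root l w hn'
    have hvr : I.root ≠ v := fun e => hr (by simp [e])
    have hvw : v ≠ w := fun e => hv (by simp [e])
    have hwr : w ≠ I.root := fun e => hr (by simp [e])
    have hvp : v ∉ p.support := by rw [hp1]; exact hv
    refine ⟨SimpleGraph.Walk.cons (by simpa using hvr)
      (SimpleGraph.Walk.cons (by simpa using hvw) p), Or.inr (Or.inr ?_), ?_, ?_⟩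
    · rw [SimpleGraph.Walk.cons_isCycle_iff]
      constructor
      · rw [SimpleGraph.Walk.isPath_def, SimpleGraph.Walk.support_cons, hp1]
        exact hnodup
      · rw [SimpleGraph.Walk.edges_cons, List.mem_cons, not_or]
        constructor
        · intro e
          rcases Sym2.eq_iff.1 e with h | h
          · exact hvr h.1
          · exact hwr h.1.symm
        · exact fun e => hvp (SimpleGraph.Walk.snd_mem_support_of_mem_edges _ e)
    · intro x
      simp [hp1]; tauto
    · simp [pathLen, dist, hvr, hvw, hp2]

end

end

/-! ### Correcting the parity of a tree -/

section

variable {V : Type u} {r : V}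

/-- `a` is an ancestor of `v`, or `v` itself. -/
def RootedTree.Anc (T : RootedTree V r) : V → V → Prop :=
  Relation.ReflTransGen fun a b => b ∈ T.verts ∧ b ≠ r ∧ T.parent b = a

/-- The largest value of `y` on the descendants of each vertex. -/
theorem RootedTree.exists_subtree_max (T : RootedTree V r) (y : V → ℝ) :
    ∃ η : V → ℝ, ∀ w ∈ T.verts, (∃ v ∈ T.verts, T.Anc w v ∧ y v = η w) ∧
      ∀ v ∈ T.verts, T.Anc w v → y v ≤ η w := by
  classical
  have h : ∀ w, ∃ t : ℝ, w ∈ T.verts → (∃ v ∈ T.verts, T.Anc w v ∧ y v = t) ∧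
      ∀ v ∈ T.verts, T.Anc w v → y v ≤ t := by
    intro w
    by_cases hw : w ∈ T.verts
    · obtain ⟨v, hv, hmax⟩ := (T.verts.filter (T.Anc w)).exists_max_image y
        ⟨w, Finset.mem_filter.2 ⟨hw, Relation.ReflTransGen.refl⟩⟩
      obtain ⟨hv1, hv2⟩ := Finset.mem_filter.1 hv
      exact ⟨y v, fun _ => ⟨⟨v, hv1, hv2, rfl⟩, fun v' h1 h2 =>
        hmax v' (Finset.mem_filter.2 ⟨h1, h2⟩)⟩⟩
    · exact ⟨0, fun h => absurd h hw⟩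
  choose η hη using h
  exact ⟨η, hη⟩

/-- The part of a tree needed to reach all vertices `v` with `γ ≤ y v`. -/
theorem RootedTree.exists_core (T : RootedTree V r) {y η : V → ℝ}
    (hη : ∀ w ∈ T.verts, (∃ v ∈ T.verts, T.Anc w v ∧ y v = η w) ∧
      ∀ v ∈ T.verts, T.Anc w v → y v ≤ η w) {γ : ℝ} (hγ : γ ≤ y r) :
    ∃ T' : RootedTree V r, T'.verts = T.verts.filter (γ ≤ η ·) ∧ T'.parent = T.parent ∧
      ∀ w ∈ T'.verts, ∃ v, T'.Anc w v ∧ η w = y v := by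
  have hmono : ∀ w ∈ T.verts, w ≠ r → η w ≤ η (T.parent w) := by
    intro w hw hwr
    obtain ⟨v, hv, hwv, e⟩ := (hη w hw).1
    rw [← e]
    exact (hη _ (T.parent_mem w hw hwr)).2 v hv (Relation.ReflTransGen.head ⟨hw, hwr, rfl⟩ hwv)
  refine ⟨⟨T.verts.filter (γ ≤ η ·), T.parent, T.rank, ?_, ?_, ?_⟩, rfl, rfl, ?_⟩
  · exact Finset.mem_filter.2
      ⟨T.root_mem, hγ.trans ((hη r T.root_mem).2 r T.root_mem Relation.ReflTransGen.refl)⟩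
  · intro v hv hvr
    obtain ⟨h1, h2⟩ := Finset.mem_filter.1 hv
    exact Finset.mem_filter.2 ⟨T.parent_mem v h1 hvr, h2.trans (hmono v h1 hvr)⟩
  · intro v hv hvr
    exact T.rank_parent_lt v (Finset.mem_filter.1 hv).1 hvr
  · intro w hw
    obtain ⟨h1, h2⟩ := Finset.mem_filter.1 hw
    obtain ⟨v, hv, hwv, e⟩ := (hη w h1).1
    refine ⟨v, ?_, e.symm⟩
    -- the value `η` is at least `γ` on the whole path from `w` to `v`
    rw [← e] at h2
    clear hw h1 e
    induction hwv using Relation.ReflTransGen.head_induction_on with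
    | refl => exact Relation.ReflTransGen.refl
    | @head a b hab hbv ih =>
      refine Relation.ReflTransGen.head ⟨Finset.mem_filter.2 ⟨hab.1, ?_⟩, hab.2⟩ ih
      exact h2.trans ((hη b hab.1).2 v hv hbv)

variable [DecidableEq V]

/-- The edges of a tree as a multiset of ordered pairs. -/
def RootedTree.edgeMultiset (T : RootedTree V r) : Multiset (V × V) :=
  (T.verts.erase r).val.map fun w => (w, T.parent w)

theorem RootedTree.reaches (T : RootedTree V r) {E : Multiset (V × V)} (hE : T.edgeMultiset ≤ E) :
    ∀ v ∈ T.verts, Relation.ReflTransGen (MultiAdj E) r v := by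
  have h : ∀ (n : ℕ), ∀ v ∈ T.verts, T.rank v = n → Relation.ReflTransGen (MultiAdj E) r v := by
    intro n
    induction n using Nat.strong_induction_on with
    | _ n ih =>
    intro v hv hn
    by_cases hvr : v = r
    · rw [hvr]
    · refine (ih _ (hn ▸ T.rank_parent_lt v hv hvr) _ (T.parent_mem v hv hvr) rfl).tail
        (Or.inr (Multiset.mem_of_le hE ?_))
      exact Multiset.mem_map.2 ⟨v, Finset.mem_erase.2 ⟨hvr, hv⟩, rfl⟩
  exact fun v hv => h _ v hv rfl

theorem sum_multiDegree_edgeMultiset (T : RootedTree V r) (S : Finset V) :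
    ∑ v ∈ S, multiDegree T.edgeMultiset v
      = ∑ w ∈ T.verts.erase r, ((if w ∈ S then 1 else 0) + if T.parent w ∈ S then 1 else 0) := by
  have h : ∀ v, multiDegree T.edgeMultiset v
      = ∑ w ∈ T.verts.erase r, ((if v = w then 1 else 0) + if v = T.parent w then 1 else 0) := by
    intro v
    rw [multiDegree, RootedTree.edgeMultiset, Multiset.map_map, Multiset.map_map,
      Multiset.count_map, Multiset.count_map, Finset.sum_add_distrib, Finset.sum_boole,
      Finset.sum_boole]
    rfl
  simp only [h]
  rw [Finset.sum_comm]
  refine Finset.sum_congr rfl fun w _ => ?_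
  rw [Finset.sum_add_distrib, Finset.sum_ite_eq', Finset.sum_ite_eq']

theorem sum_map_edgeMultiset (T : RootedTree V r) (c : V → V → ℝ) :
    (T.edgeMultiset.map fun e => c e.1 e.2).sum = T.cost c := by
  rw [RootedTree.edgeMultiset, Multiset.map_map]; rfl

/-- The edges of a perfect matching of `Q`, each taken once. -/
theorem IsPerfectMatching.exists_multiset {Q : Finset V} {M : {v // v ∈ Q} → {v // v ∈ Q}}
    (hM : IsPerfectMatching M) {c : V → V → ℝ} (hc : ∀ u v, c u v = c v u) :
    ∃ E : Multiset (V × V), (∀ v, multiDegree E v = if v ∈ Q then 1 else 0) ∧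
      2 * (E.map fun e => c e.1 e.2).sum = ∑ v : {v // v ∈ Q}, c v (M v) := by
  let e := Fintype.equivFin {v // v ∈ Q}
  let A : Finset {v // v ∈ Q} := Finset.univ.filter fun a => e a < e (M a)
  have hA : ∀ a, M a ∈ A ↔ a ∉ A := by
    intro a
    have hne : e (M a) ≠ e a := fun h => hM.ne a (e.injective h)
    simp only [A, Finset.mem_filter, Finset.mem_univ, true_and, hM.invol]
    rw [not_lt]
    exact ⟨le_of_lt, fun h => lt_of_le_of_ne h hne⟩
  have hMinj : Function.Injective M := fun a b h => by rw [← hM.invol a, h, hM.invol]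
  have hcount : ∀ (B : Finset {v // v ∈ Q}) (f : {v // v ∈ Q} → {v // v ∈ Q}),
      Function.Injective f → ∀ b : {v // v ∈ Q},
      (B.val.map fun a => (f a).1).count (f b).1 = if b ∈ B then 1 else 0 := by
    intro B f hf b
    have hinj : Function.Injective fun a => (f a).1 := Subtype.val_injective.comp hf
    rw [Multiset.count_map_eq_count' (fun a => (f a).1) _ hinj]
    split_ifs with h
    · exact Multiset.count_eq_one_of_mem B.nodup h
    · exact Multiset.count_eq_zero.2 h
  refine ⟨A.val.map fun a => (a.1, (M a).1), fun v => ?_, ?_⟩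
  · rw [multiDegree, Multiset.map_map, Multiset.map_map]
    change (A.val.map fun a => a.1).count v + (A.val.map fun a => (M a).1).count v = _
    by_cases hv : v ∈ Q
    · have h1 := hcount A id Function.injective_id ⟨v, hv⟩
      have h2 := hcount A M hMinj (M ⟨v, hv⟩)
      rw [hM.invol] at h2
      simp only [id] at h1 h2
      rw [h1, h2, if_pos hv]
      by_cases h3 : (⟨v, hv⟩ : {v // v ∈ Q}) ∈ A
      · rw [if_pos h3, if_neg fun h => (hA _).1 h h3]
      · rw [if_neg h3, if_pos ((hA _).2 h3)]
    · rw [if_neg hv, Nat.add_eq_zero_iff, Multiset.count_eq_zero, Multiset.count_eq_zero]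
      constructor <;> intro h <;> obtain ⟨a, -, rfl⟩ := Multiset.mem_map.1 h
      · exact hv a.2
      · exact hv (M a).2
  · rw [Multiset.map_map]
    change 2 * ∑ a ∈ A, c a (M a) = _
    rw [← Finset.sum_add_sum_compl A, two_mul]
    congr 1
    refine Finset.sum_bij (fun a _ => M a) (fun a ha => ?_) (fun a _ b _ h => hMinj h)
      (fun b hb => ⟨M b, (hA b).2 (Finset.mem_compl.1 hb), hM.invol b⟩) fun a _ => ?_
    · rw [Finset.mem_compl, hA, not_not]; exact ha
    · rw [hM.invol, hc]

variable [Fintype V]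

/-- The vertices of odd degree of a tree. -/
def RootedTree.oddVerts (T : RootedTree V r) : Finset V :=
  Finset.univ.filter fun v => Odd (multiDegree T.edgeMultiset v)

theorem RootedTree.even_card_oddVerts (T : RootedTree V r) : Even T.oddVerts.card := by
  have h : ¬ Odd (∑ v, multiDegree T.edgeMultiset v) := by
    rw [sum_multiDegree]
    exact Nat.not_odd_iff_even.2 (even_two_mul _)
  rw [Finset.odd_sum_iff_odd_card_odd] at h
  exact Nat.not_odd_iff_even.1 h

/-- Weights that correct the parity of a tree: a third of the fractional solution, plus on each tree
edge as much as is needed for the cuts containing no other tree edge. Since `η ≤ 1`, this is at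
least a third on each tree edge, which suffices for cuts containing three of them. -/
noncomputable def RootedTree.joinWeight (T : RootedTree V r) (x : V → V → ℝ) (η : V → ℝ)
    (i j : V) : ℝ :=
  x i j / 3 + ∑ w ∈ T.verts.erase r, (1 - 2 * η w / 3) * edgeWeight w (T.parent w) i j

theorem RootedTree.isFractionalJoin_joinWeight (T : RootedTree V r) {x : V → V → ℝ} {y η : V → ℝ}
    (hxs : ∀ u v, x u v = x v u) (hx0 : ∀ u v, 0 ≤ x u v) (hxd : ∀ v, x v v = 0)
    (hcut : ∀ S : Finset V, r ∉ S → ∀ v ∈ S, 2 * y v ≤ cutWeight x S)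
    (hη1 : ∀ w ∈ T.verts, η w ≤ 1) (hη : ∀ w ∈ T.verts, ∃ v, T.Anc w v ∧ η w = y v) :
    IsFractionalJoin T.oddVerts (T.joinWeight x η) := by
  have hη1' : ∀ w ∈ T.verts.erase r, (1 : ℝ) / 3 ≤ 1 - 2 * η w / 3 := fun w hw => by
    have := hη1 w (Finset.mem_of_mem_erase hw)
    linarith
  have hsymm : ∀ u v, T.joinWeight x η u v = T.joinWeight x η v u := fun u v => by
    unfold RootedTree.joinWeight
    rw [hxs u v, Finset.sum_congr rfl fun w _ => by rw [edgeWeight_symm _ _ u v]]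
  refine ⟨hsymm, fun u v => ?_, fun v => ?_, fun S hS => ?_⟩
  · refine add_nonneg (div_nonneg (hx0 u v) (by norm_num)) (Finset.sum_nonneg fun w hw => ?_)
    exact mul_nonneg (by linarith [hη1' w hw]) (edgeWeight_nonneg _ _ _ _)
  · simp [RootedTree.joinWeight, hxd, edgeWeight]
  wlog hr : r ∉ S generalizing S
  · rw [← cutWeight_compl hsymm]
    refine this Sᶜ ?_ (by simpa using hr)
    have h5 : (S ∩ T.oddVerts).card + (Sᶜ ∩ T.oddVerts).card = T.oddVerts.card := by
      rw [← Finset.card_union_of_disjoint, ← Finset.union_inter_distrib_right,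
        Finset.union_compl, Finset.univ_inter]
      exact Finset.disjoint_of_subset_left Finset.inter_subset_left
        (Finset.disjoint_of_subset_right Finset.inter_subset_left disjoint_compl_right)
    have hQ := T.even_card_oddVerts
    rw [← h5] at hQ
    exact (Nat.even_add'.1 hQ).1 hS
  -- the tree edges in the cut
  set D := (T.verts.erase r).filter fun w => ¬ (w ∈ S ↔ T.parent w ∈ S) with hD
  have hcutz : cutWeight (T.joinWeight x η) S = cutWeight x S / 3 + ∑ w ∈ D, (1 - 2 * η w / 3) := by
    have h1 : cutWeight (T.joinWeight x η) S = cutWeight x S / 3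
        + ∑ w ∈ T.verts.erase r, (1 - 2 * η w / 3) * cutWeight (edgeWeight w (T.parent w)) S := by
      simp only [cutWeight, RootedTree.joinWeight, Finset.sum_add_distrib, ← Finset.sum_div]
      congr 1
      rw [Finset.sum_congr rfl fun i _ => Finset.sum_comm, Finset.sum_comm]
      simp only [Finset.mul_sum]
    rw [h1, hD, Finset.sum_filter]
    congr 1
    refine Finset.sum_congr rfl fun w _ => ?_
    rw [cutWeight_edgeWeight]
    split_ifs <;> simp
  have hDodd : Odd D.card := by
    have h1 : Odd (∑ v ∈ S, multiDegree T.edgeMultiset v) := by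
      rw [Finset.odd_sum_iff_odd_card_odd]
      convert hS using 2
      ext v; simp [RootedTree.oddVerts]
    rw [sum_multiDegree_edgeMultiset, Finset.odd_sum_iff_odd_card_odd] at h1
    convert h1 using 3 with w
    by_cases h1 : w ∈ S <;> by_cases h2 : T.parent w ∈ S <;> simp [h1, h2]
  have hx : 0 ≤ cutWeight x S := Finset.sum_nonneg fun _ _ => Finset.sum_nonneg fun _ _ => hx0 _ _
  rw [hcutz]
  by_cases hD3 : 3 ≤ D.card
  · have h1 : ∑ w ∈ D, ((1 : ℝ) / 3) ≤ ∑ w ∈ D, (1 - 2 * η w / 3) :=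
      Finset.sum_le_sum fun w hw => hη1' w (Finset.mem_filter.1 hw).1
    rw [Finset.sum_const, nsmul_eq_mul] at h1
    have h2 : (3 : ℝ) ≤ D.card := by exact_mod_cast hD3
    linarith
  · obtain ⟨k, hk⟩ := hDodd
    obtain ⟨w, hw⟩ := Finset.card_eq_one.1 (by omega : D.card = 1)
    have hDmem : ∀ v ∈ T.verts, v ≠ r → v ≠ w → (v ∈ S ↔ T.parent v ∈ S) := by
      intro v hv hvr hvw
      by_contra hne
      have : v ∈ D := Finset.mem_filter.2 ⟨Finset.mem_erase.2 ⟨hvr, hv⟩, hne⟩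
      rw [hw, Finset.mem_singleton] at this
      exact hvw this
    have hwD : w ∈ D := by rw [hw]; exact Finset.mem_singleton_self w
    obtain ⟨hwE, hwne⟩ := Finset.mem_filter.1 hwD
    obtain ⟨hwr, hwT⟩ := Finset.mem_erase.1 hwE
    -- above `w` the tree does not meet `S`
    have hup : ∀ (n : ℕ), ∀ u ∈ T.verts, T.rank u = n → n < T.rank w → u ∉ S := by
      intro n
      induction n using Nat.strong_induction_on with
      | _ n ih =>
      intro u hu hn hlt huS
      have hur : u ≠ r := fun e => hr (e ▸ huS)
      have huw : u ≠ w := fun e => by rw [e] at hn; omega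
      have h1 := T.rank_parent_lt u hu hur
      exact ih _ (hn ▸ h1) _ (T.parent_mem u hu hur) rfl (by omega)
        ((hDmem u hu hur huw).1 huS)
    have hpS : T.parent w ∉ S :=
      hup _ _ (T.parent_mem w hwT hwr) rfl (T.rank_parent_lt w hwT hwr)
    have hwS : w ∈ S := by tauto
    obtain ⟨v, hwv, hv⟩ := hη w hwT
    have hvS : v ∈ S := by
      clear hv
      induction hwv with
      | refl => exact hwS
      | @tail a b _ hab ih =>
        by_cases hbw : b = w
        · rwa [hbw]
        · rw [hDmem b hab.1 hab.2.1 hbw, hab.2.2]; exact ih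
    have h1 := hcut S hr v hvS
    rw [hw, Finset.sum_singleton, hv]
    linarith

/-- Correcting the parity of a tree yields a tour through its vertices. -/
theorem RootedTree.exists_tour (T : RootedTree V r) {c x : V → V → ℝ} {y η : V → ℝ}
    (hc : IsMetric c) (hxs : ∀ u v, x u v = x v u) (hx0 : ∀ u v, 0 ≤ x u v) (hxd : ∀ v, x v v = 0)
    (hcut : ∀ S : Finset V, r ∉ S → ∀ v ∈ S, 2 * y v ≤ cutWeight x S)
    (hη1 : ∀ w ∈ T.verts, η w ≤ 1) (hη : ∀ w ∈ T.verts, ∃ v, T.Anc w v ∧ η w = y v) :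
    ∃ l : List V, (r :: l).Nodup ∧ (∀ v ∈ T.verts, v ∈ r :: l) ∧
      pathLen c r (l ++ [r]) ≤ ∑ w ∈ T.verts.erase r, c w (T.parent w) * (2 - 2 * η w / 3)
        + (∑ u, ∑ v, c u v * x u v) / 6 := by
  have hz := T.isFractionalJoin_joinWeight hxs hx0 hxd hcut hη1 hη
  obtain ⟨M, hM, hMc⟩ := hz.exists_matching T.even_card_oddVerts hc
  obtain ⟨E, hE, hEc⟩ := hM.exists_multiset hc.symm
  have hdeg : ∀ v, Even (multiDegree (T.edgeMultiset + E) v) := by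
    intro v
    have h1 : multiDegree (T.edgeMultiset + E) v
        = multiDegree T.edgeMultiset v + multiDegree E v := by
      simp only [multiDegree, Multiset.map_add, Multiset.count_add]; omega
    rw [h1, hE]
    by_cases hv : Odd (multiDegree T.edgeMultiset v)
    · have hvQ : v ∈ T.oddVerts := Finset.mem_filter.2 ⟨Finset.mem_univ _, hv⟩
      rw [if_pos hvQ]
      exact hv.add_one
    · have hvQ : v ∉ T.oddVerts := fun h => hv (Finset.mem_filter.1 h).2
      rw [if_neg hvQ]
      exact Nat.not_odd_iff_even.1 hv
  obtain ⟨l, hl1, hl2, hl3⟩ := exists_nodup_tour hc (T.edgeMultiset + E) r hdeg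
  refine ⟨l, hl1, fun v hv => hl3 v (T.reaches (Multiset.le_add_right _ _) v hv), hl2.trans ?_⟩
  rw [Multiset.map_add, Multiset.sum_add, sum_map_edgeMultiset]
  have hzc : ∑ i, ∑ j, c i j * T.joinWeight x η i j = (∑ u, ∑ v, c u v * x u v) / 3
      + 2 * ∑ w ∈ T.verts.erase r, (1 - 2 * η w / 3) * c w (T.parent w) := by
    have h1 : ∀ i j, c i j * T.joinWeight x η i j = c i j * x i j / 3
        + ∑ w ∈ T.verts.erase r, (1 - 2 * η w / 3) * (c i j * edgeWeight w (T.parent w) i j) := by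
      intro i j
      rw [RootedTree.joinWeight, mul_add, Finset.mul_sum]
      congr 1
      · ring
      · exact Finset.sum_congr rfl fun w _ => by ring
    simp only [h1, Finset.sum_add_distrib, ← Finset.sum_div]
    congr 1
    rw [Finset.sum_congr rfl fun i _ => Finset.sum_comm, Finset.sum_comm, Finset.mul_sum]
    refine Finset.sum_congr rfl fun w _ => ?_
    simp only [← Finset.mul_sum]
    rw [sum_mul_edgeWeight hc.symm hc.diag]; ring
  have hsum : ∑ w ∈ T.verts.erase r, c w (T.parent w) * (2 - 2 * η w / 3)
      = T.cost c + ∑ w ∈ T.verts.erase r, (1 - 2 * η w / 3) * c w (T.parent w) := by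
    rw [RootedTree.cost, ← Finset.sum_add_distrib]
    exact Finset.sum_congr rfl fun w _ => by ring
  rw [hsum]
  linarith

end

/-! ### Choosing the threshold -/

section

/-- A monotone nonnegative function on a finite set `Y` is the cumulative distribution function of
nonnegative weights on `Y`. -/
theorem exists_weights (f : ℝ → ℝ) : ∀ Y : Finset ℝ, (∀ t ∈ Y, 0 ≤ f t) →
    (∀ s ∈ Y, ∀ t ∈ Y, s ≤ t → f s ≤ f t) →
    ∃ p : ℝ → ℝ, (∀ t ∈ Y, 0 ≤ p t) ∧ ∀ t ∈ Y, ∑ s ∈ Y with s ≤ t, p s = f t := by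
  intro Y
  induction Y using Finset.induction_on_max with
  | empty => exact fun _ _ => ⟨0, by simp, by simp⟩
  | insert m Y hm ih =>
    intro h0 hmono
    obtain ⟨p, hp0, hp⟩ := ih (fun t ht => h0 t (Finset.mem_insert_of_mem ht))
      (fun s hs t ht => hmono s (Finset.mem_insert_of_mem hs) t (Finset.mem_insert_of_mem ht))
    have hmY : m ∉ Y := fun h => lt_irrefl _ (hm m h)
    have htotal : ∑ s ∈ Y, p s ≤ f m := by
      rcases Y.eq_empty_or_nonempty with rfl | hne
      · simpa using h0 m (Finset.mem_insert_self _ _)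
      · have h1 := hp _ (Y.max'_mem hne)
        rw [Finset.filter_true_of_mem fun s hs => Y.le_max' s hs] at h1
        rw [h1]
        exact hmono _ (Finset.mem_insert_of_mem (Y.max'_mem hne)) _ (Finset.mem_insert_self _ _)
          (hm _ (Y.max'_mem hne)).le
    have hupd : ∀ s ∈ Y, Function.update p m (f m - ∑ s ∈ Y, p s) s = p s := fun s hs =>
      Function.update_of_ne (fun e : s = m => hmY (e ▸ hs)) _ _
    refine ⟨Function.update p m (f m - ∑ s ∈ Y, p s), fun t ht => ?_, fun t ht => ?_⟩
    · rcases Finset.mem_insert.1 ht with rfl | ht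
      · rw [Function.update_self]; linarith
      · rw [hupd t ht]; exact hp0 t ht
    · rcases Finset.mem_insert.1 ht with rfl | ht
      · rw [Finset.filter_true_of_mem, Finset.sum_insert hmY, Function.update_self,
          Finset.sum_congr rfl hupd]
        · ring
        · intro s hs
          rcases Finset.mem_insert.1 hs with rfl | hs
          · exact le_rfl
          · exact (hm s hs).le
      · rw [Finset.filter_insert, if_neg (not_le.2 (hm t ht)), ← hp t ht]
        exact Finset.sum_congr rfl fun s hs => hupd s (Finset.mem_filter.1 hs).1

/-- The distribution function of the random threshold. It is chosen such that a vertex with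
`y v = t`, which is visited with probability `t * thresholdCDF t`, is missed with probability at
most `5 / 3 * (1 - t)`. -/
noncomputable def thresholdCDF (t : ℝ) : ℝ := max 0 ((5 * t - 2) / (3 * t))

theorem thresholdCDF_nonneg (t : ℝ) : 0 ≤ thresholdCDF t := le_max_left _ _

theorem thresholdCDF_one : thresholdCDF 1 = 1 := by
  norm_num [thresholdCDF]

theorem thresholdCDF_mono {s t : ℝ} (hs : 0 ≤ s) (hst : s ≤ t) :
    thresholdCDF s ≤ thresholdCDF t := by
  rcases hs.eq_or_lt with rfl | hs
  · have : thresholdCDF 0 = 0 := by norm_num [thresholdCDF]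
    rw [this]; exact thresholdCDF_nonneg t
  · refine max_le_max le_rfl ?_
    rw [div_le_div_iff₀ (by linarith) (by linarith)]
    nlinarith

theorem le_mul_thresholdCDF {t : ℝ} (ht : 0 ≤ t) : 5 / 3 * t - 2 / 3 ≤ t * thresholdCDF t := by
  rcases ht.eq_or_lt with rfl | ht
  · norm_num
  · have h1 := mul_le_mul_of_nonneg_left (le_max_right 0 ((5 * t - 2) / (3 * t))) ht.le
    refine le_trans (le_of_eq ?_) h1
    field_simp

theorem thresholdCDF_mul_le {t : ℝ} (ht : 0 ≤ t) (ht1 : t ≤ 1) :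
    thresholdCDF t * (2 - 2 * t / 3) ≤ 4 / 3 := by
  have h2 : 0 ≤ 2 - 2 * t / 3 := by linarith
  rw [thresholdCDF, max_mul_of_nonneg _ _ h2]
  refine max_le (by norm_num) ?_
  rcases ht.eq_or_lt with rfl | ht
  · norm_num
  · rw [div_mul_eq_mul_div, div_le_iff₀ (by linarith)]
    nlinarith

section
variable {V : Type u} [Fintype V] [DecidableEq V]

theorem sum_cut (S : Finset V) (f : Sym2 V → ℝ) :
    ∑ e ∈ cut S, f e = ∑ u ∈ S, ∑ v ∈ Sᶜ, f s(u, v) := by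
  classical
  rw [← Finset.sum_product']
  symm
  refine Finset.sum_bij (fun p _ => s(p.1, p.2)) ?_ ?_ ?_ (fun _ _ => rfl)
  · intro p hp
    obtain ⟨h1, h2⟩ := Finset.mem_product.1 hp
    have h3 := Finset.mem_compl.1 h2
    have h4 : p.1 ≠ p.2 := fun e => h3 (e ▸ h1)
    simp only [cut, edges, Finset.mem_filter, SimpleGraph.mem_edgeFinset]
    exact ⟨by simpa using h4, p.1, h1, p.2, h3, rfl⟩
  · intro p hp q hq h
    obtain ⟨h1, h2⟩ := Finset.mem_product.1 hp
    obtain ⟨h3, h4⟩ := Finset.mem_product.1 hq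
    rcases Sym2.eq_iff.1 h with ⟨h5, h6⟩ | ⟨h5, h6⟩
    · exact Prod.ext h5 h6
    · have h7 : p.1 = q.2 := h5
      exact absurd (h7 ▸ h1) (Finset.mem_compl.1 h4)
  · intro e he
    simp only [cut, Finset.mem_filter] at he
    obtain ⟨-, u, hu, v, hv, rfl⟩ := he
    exact ⟨(u, v), Finset.mem_product.2 ⟨hu, Finset.mem_compl.2 hv⟩, rfl⟩

theorem sum_edges (f : Sym2 V → ℝ) :
    2 * ∑ e ∈ edges V, f e = ∑ u, ∑ v, if u = v then 0 else f s(u, v) := by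
  classical
  have h1 : ∑ u : V, ∑ v : V, (if u = v then 0 else f s(u, v))
      = ∑ p ∈ (Finset.univ : Finset V).offDiag, f s(p.1, p.2) := by
    have h2 : (Finset.univ : Finset V).offDiag
        = (Finset.univ ×ˢ Finset.univ).filter fun p => ¬ p.1 = p.2 := by
      ext p; simp
    rw [← Finset.sum_product', h2, Finset.sum_filter]
    exact Finset.sum_congr rfl fun p _ => by split_ifs <;> rfl
  rw [h1, ← Finset.sum_fiberwise_of_maps_to (t := edges V)
    (g := fun p : V × V => s(p.1, p.2))]
  · rw [Finset.mul_sum]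
    refine Finset.sum_congr rfl fun e he => ?_
    induction e with | _ a b =>
    have hab : a ≠ b := by simpa [edges] using he
    have h2 : (Finset.univ : Finset V).offDiag.filter (fun p => s(p.1, p.2) = s(a, b))
        = {(a, b), (b, a)} := by
      ext ⟨u, v⟩
      simp only [Finset.mem_filter, Finset.mem_offDiag, Finset.mem_univ, true_and, Sym2.eq_iff,
        Finset.mem_insert, Finset.mem_singleton, Prod.mk.injEq]
      constructor
      · exact fun h => h.2
      · rintro (⟨rfl, rfl⟩ | ⟨rfl, rfl⟩)
        · exact ⟨hab, Or.inl ⟨rfl, rfl⟩⟩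
        · exact ⟨hab.symm, Or.inr ⟨rfl, rfl⟩⟩
    rw [h2, Finset.sum_pair (by simp [hab]), Sym2.eq_swap (a := b)]
    ring
  · intro p hp
    have := (Finset.mem_offDiag.1 hp).2.2
    simpa [edges] using this

theorem Instance.tourCost_le (I : Instance V) {l : List V} (hl : (I.root :: l).Nodup)
    {P : V → Prop} [DecidablePred P] (hP : ∀ v, P v → v ∈ I.root :: l) :
    ∃ C : (⊤ : SimpleGraph V).Walk I.root I.root, IsTour C ∧
      I.tourCost C ≤ pathLen I.dist I.root (l ++ [I.root])
        + ∑ v, I.penalty v * (1 - if P v then 1 else 0) := by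
  obtain ⟨C, hC, hsupp, hlen⟩ := I.exists_tour_of_nodup l hl
  refine ⟨C, hC, ?_⟩
  have hpen : ∀ v, 0 ≤ I.penalty v := fun v => by
    by_cases h : v = I.root
    · rw [h, I.penalty_root]
    · exact I.penalty_nonneg v h
  rw [tourCost, hlen, Finset.sum_filter]
  gcongr with v
  by_cases h1 : v ∈ C.support
  · rw [if_neg (not_not.2 h1)]
    exact mul_nonneg (hpen v) (by split_ifs <;> norm_num)
  · have h2 : ¬ P v := fun h2 => h1 ((hsupp v).2 (hP v h2))
    simp [h1, h2]

/-- Every feasible solution of the relaxation is matched by a tour that costs at most `5 / 3` times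
as much. -/
theorem Instance.exists_tour_le (I : Instance V) {x : Sym2 V → ℝ} {y : V → ℝ}
    (h : LPFeasible I.root x y) :
    ∃ C : (⊤ : SimpleGraph V).Walk I.root I.root, IsTour C ∧
      I.tourCost C ≤ 5 / 3 * I.lpCost x y := by
  classical
  let X : V → V → ℝ := fun u v => if u = v then 0 else x s(u, v)
  let F := thresholdCDF
  have hc := I.isMetric_dist
  have hX0 : ∀ u v, 0 ≤ X u v := fun u v => by
    by_cases huv : u = v
    · simp [X, huv]
    · simp only [X, huv, if_false]
      exact h.x_nonneg _ (by simpa [edges] using huv)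
  have hXs : ∀ u v, X u v = X v u := fun u v => by
    by_cases huv : u = v
    · rw [huv]
    · simp [X, huv, Ne.symm huv, Sym2.eq_swap]
  have hXd : ∀ v, X v v = 0 := fun v => by simp [X]
  have hcut : ∀ S : Finset V, I.root ∉ S → ∀ v ∈ S, 2 * y v ≤ cutWeight X S := by
    intro S hS v hv
    refine (h.cut_ge S hS v hv).trans (le_of_eq ?_)
    rw [sum_cut, cutWeight]
    refine Finset.sum_congr rfl fun u hu => Finset.sum_congr rfl fun w hw => ?_
    have : u ≠ w := fun e => Finset.mem_compl.1 hw (e ▸ hu)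
    simp [X, this]
  have hy0 : ∀ v, 0 ≤ y v := fun v => (h.y_mem v).1
  have hy1 : ∀ v, y v ≤ 1 := fun v => (h.y_mem v).2
  have hpen : ∀ v, 0 ≤ I.penalty v := fun v => by
    by_cases hv : v = I.root
    · rw [hv, I.penalty_root]
    · exact I.penalty_nonneg v hv
  have hlp : I.lpCost x y = (∑ u, ∑ v, I.dist u v * X u v) / 2 + ∑ v, I.penalty v * (1 - y v) := by
    have h1 := sum_edges fun e => I.length e * x e
    have h2 : ∑ u, ∑ v, (if u = v then 0 else I.length s(u, v) * x s(u, v))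
        = ∑ u, ∑ v, I.dist u v * X u v := by
      refine Finset.sum_congr rfl fun u _ => Finset.sum_congr rfl fun v _ => ?_
      by_cases huv : u = v <;> simp [X, dist, huv]
    rw [lpCost]; linarith
  -- a tree balancing its length against the penalties it saves
  have hsol : IsCutSolution I.root Finset.univ I.dist (fun v => 3 / 8 * (I.penalty v * F (y v)))
      X y :=
    { root_mem := Finset.mem_univ _
      len_symm := hc.symm
      len_nonneg := fun u _ v _ _ => hc.nonneg u v
      pen_nonneg := fun v _ => mul_nonneg (by norm_num)
        (mul_nonneg (hpen v) (thresholdCDF_nonneg _))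
      symm := hXs
      nonneg := hX0
      diag := hXd
      le_one := fun v _ => hy1 v
      cut := fun S hS v hv => by
        have hr : I.root ∉ S := fun hr => by simpa using hS hr
        have := hcut S hr v hv
        rwa [cutWeight, Finset.compl_eq_univ_sdiff] at this }
  obtain ⟨T, -, hT⟩ := IsCutSolution.hasCheapTree _ hsol rfl
  obtain ⟨η, hη⟩ := T.exists_subtree_max y
  have hη01 : ∀ w ∈ T.verts, 0 ≤ η w ∧ η w ≤ 1 := fun w hw => by
    obtain ⟨v, -, -, e⟩ := (hη w hw).1
    exact e ▸ ⟨hy0 v, hy1 v⟩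
  -- the tour obtained from threshold `γ`
  let A : ℝ → ℝ := fun γ =>
    ∑ w ∈ T.verts.erase I.root, (if γ ≤ η w then I.dist w (T.parent w) * (2 - 2 * η w / 3) else 0)
      + (∑ u, ∑ v, I.dist u v * X u v) / 6
      + ∑ v, I.penalty v * (1 - if v ∈ T.verts ∧ γ ≤ y v then 1 else 0)
  have htour : ∀ γ ≤ 1, ∃ C : (⊤ : SimpleGraph V).Walk I.root I.root, IsTour C ∧
      I.tourCost C ≤ A γ := by
    intro γ hγ
    obtain ⟨T', hT'v, hT'p, hT'η⟩ := T.exists_core hη (γ := γ) (by rwa [h.y_root])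
    obtain ⟨l, hl, hcov, hlen⟩ := T'.exists_tour hc hXs hX0 hXd hcut
      (fun w hw => (hη01 w (Finset.mem_filter.1 (hT'v ▸ hw)).1).2) hT'η
    obtain ⟨C, hC, hcost⟩ := I.tourCost_le hl (P := fun v => v ∈ T.verts ∧ γ ≤ y v) (by
      rintro v ⟨hv, hγv⟩
      apply hcov
      rw [hT'v]
      exact Finset.mem_filter.2
        ⟨hv, hγv.trans ((hη v hv).2 v hv Relation.ReflTransGen.refl)⟩)
    refine ⟨C, hC, hcost.trans ?_⟩
    rw [hT'v, hT'p, ← Finset.filter_erase, Finset.sum_filter] at hlen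
    simp only [A]
    linarith
  -- averaging over the threshold
  let Y := Finset.univ.image y
  have hYy : ∀ v, y v ∈ Y := fun v => Finset.mem_image_of_mem _ (Finset.mem_univ v)
  have hY : ∀ t ∈ Y, 0 ≤ t ∧ t ≤ 1 := fun t ht => by
    obtain ⟨v, -, rfl⟩ := Finset.mem_image.1 ht
    exact ⟨hy0 v, hy1 v⟩
  obtain ⟨p, hp0, hp⟩ := exists_weights F Y (fun t _ => thresholdCDF_nonneg t)
    (fun s hs t _ hst => thresholdCDF_mono (hY s hs).1 hst)
  have hp1 : ∑ γ ∈ Y, p γ = 1 := by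
    have h1 := hp 1 (h.y_root ▸ hYy I.root)
    rwa [Finset.filter_true_of_mem fun t ht => (hY t ht).2, show F 1 = 1 from thresholdCDF_one]
      at h1
  have hpF : ∀ t ∈ Y, ∀ a : ℝ, ∑ γ ∈ Y, p γ * (if γ ≤ t then a else 0) = F t * a := by
    intro t ht a
    rw [← hp t ht, Finset.sum_filter, Finset.sum_mul]
    exact Finset.sum_congr rfl fun γ _ => by split_ifs <;> ring
  have havg : ∑ γ ∈ Y, p γ * A γ
      = ∑ w ∈ T.verts.erase I.root, F (η w) * (I.dist w (T.parent w) * (2 - 2 * η w / 3))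
        + (∑ u, ∑ v, I.dist u v * X u v) / 6
        + ∑ v, I.penalty v * (1 - if v ∈ T.verts then F (y v) else 0) := by
    simp only [A, mul_add, Finset.sum_add_distrib, ← Finset.sum_mul, hp1, one_mul]
    congr 1
    · congr 1
      simp only [Finset.mul_sum]
      rw [Finset.sum_comm]
      refine Finset.sum_congr rfl fun w hw => ?_
      obtain ⟨v, -, -, e⟩ := (hη w (Finset.mem_of_mem_erase hw)).1
      exact hpF _ (e ▸ hYy v) _
    · simp only [Finset.mul_sum]
      rw [Finset.sum_comm]
      refine Finset.sum_congr rfl fun v _ => ?_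
      have e : ∀ γ, p γ * (I.penalty v * (1 - if v ∈ T.verts ∧ γ ≤ y v then 1 else 0))
          = I.penalty v * (p γ - p γ * if γ ≤ y v then (if v ∈ T.verts then 1 else 0) else 0) := by
        intro γ
        by_cases h1 : v ∈ T.verts <;> by_cases h2 : γ ≤ y v <;> simp [h1, h2] <;> ring
      simp only [e]
      rw [← Finset.mul_sum, Finset.sum_sub_distrib, hp1, hpF _ (hYy v)]
      split_ifs <;> ring
  have htree : ∑ w ∈ T.verts.erase I.root, F (η w) * (I.dist w (T.parent w) * (2 - 2 * η w / 3))
      ≤ 4 / 3 * T.cost I.dist := by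
    rw [RootedTree.cost, Finset.mul_sum]
    refine Finset.sum_le_sum fun w hw => ?_
    have h1 := hη01 w (Finset.mem_of_mem_erase hw)
    have h2 := mul_le_mul_of_nonneg_right (thresholdCDF_mul_le h1.1 h1.2)
      (hc.nonneg w (T.parent w))
    calc _ = thresholdCDF (η w) * (2 - 2 * η w / 3) * I.dist w (T.parent w) := by
          simp only [F]; ring
      _ ≤ _ := h2
  have hcost : ∑ γ ∈ Y, p γ * A γ ≤ 5 / 3 * I.lpCost x y := by
    have h1 : ∑ v ∈ Finset.univ \ T.verts, 3 / 8 * (I.penalty v * F (y v))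
        = 3 / 8 * ∑ v, (I.penalty v * if v ∈ T.verts then 0 else F (y v)) := by
      rw [Finset.mul_sum, ← Finset.filter_notMem_eq_sdiff, Finset.sum_filter]
      refine Finset.sum_congr rfl fun v _ => ?_
      split_ifs <;> simp_all
    have h2 : ∑ v ∈ Finset.univ.erase I.root, 3 / 8 * (I.penalty v * F (y v)) * (1 - y v)
        = 3 / 8 * ∑ v, I.penalty v * (F (y v) * (1 - y v)) := by
      rw [Finset.mul_sum, ← Finset.sum_erase_add _ _ (Finset.mem_univ I.root), I.penalty_root]
      simp only [zero_mul, mul_zero, add_zero]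
      exact Finset.sum_congr rfl fun v _ => by ring
    rw [h1, h2] at hT
    have h3 : ∑ v, I.penalty v * (1 - if v ∈ T.verts then F (y v) else 0)
        + ∑ v, I.penalty v * (F (y v) * (1 - y v))
        ≤ 5 / 3 * ∑ v, I.penalty v * (1 - y v)
          + ∑ v, (I.penalty v * if v ∈ T.verts then 0 else F (y v)) := by
      rw [Finset.mul_sum, ← Finset.sum_add_distrib, ← Finset.sum_add_distrib]
      refine Finset.sum_le_sum fun v _ => ?_
      have h4 : 5 / 3 * y v - 2 / 3 ≤ y v * F (y v) := le_mul_thresholdCDF (hy0 v)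
      have h5 := mul_le_mul_of_nonneg_left h4 (hpen v)
      split_ifs <;> nlinarith
    rw [havg, hlp]
    linarith
  -- the best threshold is at least as good as the average
  obtain ⟨γ, hγY, hγmin⟩ := Y.exists_min_image A ⟨_, hYy I.root⟩
  obtain ⟨C, hC, hCcost⟩ := htour γ (hY γ hγY).2
  refine ⟨C, hC, hCcost.trans (le_trans ?_ hcost)⟩
  calc A γ = ∑ t ∈ Y, p t * A γ := by rw [← Finset.sum_mul, hp1, one_mul]
    _ ≤ ∑ t ∈ Y, p t * A t :=
      Finset.sum_le_sum fun t ht => mul_le_mul_of_nonneg_left (hγmin t ht) (hp0 t ht)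

end

theorem Instance.opt_le {V : Type u} [Fintype V] (I : Instance V) :
    I.opt ≤ ENNReal.ofReal (5 / 3) * I.lpOpt := by
  classical
  have h0 : ENNReal.ofReal (5 / 3) ≠ 0 := by
    rw [Ne, ENNReal.ofReal_eq_zero, not_le]; norm_num
  simp only [lpOpt]
  rw [ENNReal.mul_iInf_of_ne h0 ENNReal.ofReal_ne_top]
  refine le_iInf fun x => ?_
  rw [ENNReal.mul_iInf_of_ne h0 ENNReal.ofReal_ne_top]
  refine le_iInf fun y => ?_
  rw [ENNReal.mul_iInf_of_ne h0 ENNReal.ofReal_ne_top]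
  refine le_iInf fun h => ?_
  obtain ⟨C, hC, hcost⟩ := I.exists_tour_le h
  rw [← ENNReal.ofReal_mul (by norm_num)]
  exact (iInf₂_le C hC).trans (ENNReal.ofReal_le_ofReal hcost)

end

end PCTSP

theorem corollary2 : PCTSP.integralityGap.{u} < ENNReal.ofReal 1.774 := by
  refine lt_of_le_of_lt (b := ENNReal.ofReal (5 / 3)) ?_ ?_
  · refine iSup_le fun V => iSup_le fun _ => iSup_le fun I => ?_
    exact ENNReal.div_le_of_le_mul I.opt_le
  · rw [ENNReal.ofReal_lt_ofReal_iff (by norm_num)]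
    norm_num
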